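/- **Setting.** There are $K$ arms; the rewards of arm $i\in[K]$ have a distribution $\nu_i$ supported in $[0,1]$ with mean $\mu_i$. The best arm $i^\star=\arg\max_i\mu_i$ is unique; $\mu^\star=\mu_{i^\star}$ and $\Delta_i=\mu^\star-\mu_i>0$ for $i\ne i^\star$. Let $T\ge 2$ be the horizon. In each round $t=1,\dots,T$: (i) rewards $R^t=(R^t_i)_{i\in[K]}$ with $R^t_i\sim\nu_i$ are drawn, independently of all that happened in earlier rounds; (ii) an adaptive adversary, who sees all earlier rounds and $R^t$, chooses corrupted rewards $\tilde R^t\in[0,1]^K$; (iii) the player picks an arm $i_t$, possibly at random, with randomness independent of everything so far, and observes only $\tilde R^t_{i_t}$. The pseudo-regret is $\mathcal R(T)=\sum_{t=1}^T(\mu^\star-\mu_{i_t})$ and the total corruption is the random variable $C=\sum_{t=1}^T\|\tilde R^t-R^t\|_\infty$. **Algorithm (BARBAR), with parameters $\delta\in(0,1)$ and $T$; it does not know $C$.** Put $\lambda=1024\ln\big(\tfrac{8K}{\delta}\log_2T\big)$, $T_0=0$ and $\Delta_i^0=1$ for all $i$. For epochs $m=1,2,\dots$: let $n_i^m=\lambda(\Delta_i^{m-1})^{-2}$,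 $N_m=\sum_i n_i^m$, $T_m=T_{m-1}+N_m$ (real numbers). In each round $t$ with $T_{m-1}<t\le T_m$, pull arm $i$ with probability $n_i^m/N_m$. With $S_i^m$ the total observed reward from the pulls of arm $i$ in these rounds, let $r_i^m=S_i^m/n_i^m$, $r_\star^m=\max_i\{r_i^m-\tfrac1{16}\Delta_i^{m-1}\}$ and $\Delta_i^m=\max\{2^{-m},\,r_\star^m-r_i^m\}$. The algorithm stops after round $T$. **Theorem.** There is a universal constant $c>0$ such that, for all $K$, $T\ge2$, all reward distributions and adversaries as above: 1. for every $\delta\in(0,1)$, when BARBAR is run with parameters $\delta$ and $T$, with probability at least $1-\delta$ $$\mathcal R(T)\le c\left(KC+\sum_{i\ne i^\star}\frac{\log T}{\Delta_i}\log\Big(\frac K\delta\log T\Big)\right);$$ 2. when BARBAR is run with $\delta=1/T$, $$\mathbb E[\mathcal R(T)]\le c\left(K\,\mathbb E[C]+\sum_{i\ne i^\star}\frac{\log^2(KT)}{\Delta_i}\right).$$ -/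

import Mathlib

open MeasureTheory ProbabilityTheory

noncomputable section

namespace CorruptedBandit

/-! ### The BARBAR algorithm

Rounds are numbered `1, 2, …, T`. The history that the player sees is a pair of sequences:
`a t` is the arm pulled in round `t` and `x t` is the feedback observed in round `t`. -/

/-- The parameter `λ = 1024 ln ((8K/δ) log₂ T)`. -/
def lam (K : ℕ) (δ : ℝ) (T : ℕ) : ℝ :=
  1024 * Real.log (8 * K / δ * Real.logb 2 T)

/-- What BARBAR knows at the end of an epoch `m`: the gap estimates `Δᵢᵐ` and the end `T_m`
of the epoch, a real number. Epoch `m` consists of the rounds `t` with `T_{m-1} < t ≤ T_m`. -/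
structure EpochState (K : ℕ) where
  gap : Fin K → ℝ
  time : ℝ

/-- `nᵢ = λ Δᵢ⁻²`, the planned number of pulls of arm `i` in the epoch that follows `s`. -/
def EpochState.pulls {K : ℕ} (s : EpochState K) (l : ℝ) (i : Fin K) : ℝ :=
  l / s.gap i ^ 2

/-- `N = ∑ᵢ nᵢ`, the planned length of the epoch that follows `s`. -/
def EpochState.length {K : ℕ} (s : EpochState K) (l : ℝ) : ℝ :=
  ∑ i, s.pulls l i

/-- The average reward `rᵢ = Sᵢ / nᵢ` of arm `i` in the epoch that follows `s`, where `Sᵢ` is the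
total observed reward from the pulls of arm `i` in the rounds `t` with
`s.time < t ≤ s.time + N`. -/
def EpochState.avg {K : ℕ} (s : EpochState K) (l : ℝ) (a : ℕ → Fin K) (x : ℕ → ℝ) (i : Fin K) :
    ℝ :=
  (∑ t ∈ Finset.Ioc ⌊s.time⌋₊ ⌊s.time + s.length l⌋₊, if a t = i then x t else 0) / s.pulls l i

/-- `r⋆ = maxᵢ (rᵢ - Δᵢ / 16)` for the epoch that follows `s`. -/
def EpochState.best {K : ℕ} (s : EpochState K) (l : ℝ) (a : ℕ → Fin K) (x : ℕ → ℝ) : ℝ :=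
  ⨆ i, (s.avg l a x i - s.gap i / 16)

/-- The state of BARBAR after `m` epochs. -/
def state {K : ℕ} (l : ℝ) (a : ℕ → Fin K) (x : ℕ → ℝ) : ℕ → EpochState K
  | 0 => ⟨fun _ => 1, 0⟩
  | m + 1 =>
    ⟨fun i => max (2⁻¹ ^ (m + 1))
        ((state l a x m).best l a x - (state l a x m).avg l a x i),
      (state l a x m).time + (state l a x m).length l⟩

/-- The epoch that contains round `t`: the first `m` with `t ≤ T_m`. -/
def epoch {K : ℕ} (l : ℝ) (a : ℕ → Fin K) (x : ℕ → ℝ) (t : ℕ) : ℕ :=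
  sInf {m : ℕ | (t : ℝ) ≤ (state l a x m).time}

/-- The probability `nᵢᵐ / N_m` with which BARBAR pulls arm `i` in a round `t` of epoch `m`.
It depends on `a s`, `x s` only for the rounds `s < t`, in fact for `s ≤ T_{m-1}`. -/
def barbarProb {K : ℕ} (δ : ℝ) (T : ℕ) (a : ℕ → Fin K) (x : ℕ → ℝ) (t : ℕ) (i : Fin K) : ℝ :=
  let l := lam K δ T
  let s := state l a x (epoch l a x t - 1)
  s.pulls l i / s.length l

/-! ### The interaction of the player with the stochastic rewards and the adversary -/

/-- The information in the rounds before `t`: rewards, corrupted rewards and pulled arms. -/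
abbrev past {K : ℕ} {Ω : Type*} (R R' : ℕ → Ω → Fin K → ℝ) (I : ℕ → Ω → Fin K) (t : ℕ) :
    MeasurableSpace Ω :=
  ⨆ s ∈ Finset.Ico 1 t,
    (MeasurableSpace.comap (R s) inferInstance ⊔ MeasurableSpace.comap (R' s) inferInstance ⊔
      MeasurableSpace.comap (I s) inferInstance)

/-- What is determined when the player picks an arm in round `t`: the past, and the rewards and
the corrupted rewards of round `t`. -/
abbrev beforeChoice {K : ℕ} {Ω : Type*} (R R' : ℕ → Ω → Fin K → ℝ) (I : ℕ → Ω → Fin K) (t : ℕ) :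
    MeasurableSpace Ω :=
  past R R' I t ⊔
    (MeasurableSpace.comap (R t) inferInstance ⊔ MeasurableSpace.comap (R' t) inferInstance)

/-- `R t` are the stochastic rewards, `R' t` the corrupted rewards and `I t` the arm pulled in
round `t`, when BARBAR with parameters `δ` and `T` plays `T` rounds against an adaptive
adversary and the reward distributions `ν i`. Apart from its range, `R' t` is constrained only by
the order of events: the rewards of a round are drawn independently of everything before that
round, and the player picks the arm by fresh randomness after `R t` and `R' t` are fixed. -/
structure IsBarbarRun {K : ℕ} {Ω : Type*} [MeasurableSpace Ω] (P : Measure Ω)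
    (ν : Fin K → Measure ℝ) (δ : ℝ) (T : ℕ) (R R' : ℕ → Ω → Fin K → ℝ) (I : ℕ → Ω → Fin K) :
    Prop where
  measurable_reward : ∀ t ∈ Finset.Icc 1 T, Measurable (R t)
  measurable_corrupted : ∀ t ∈ Finset.Icc 1 T, Measurable (R' t)
  measurable_arm : ∀ t ∈ Finset.Icc 1 T, Measurable (I t)
  /-- The reward of arm `i` has the distribution `ν i`. -/
  law_reward : ∀ t ∈ Finset.Icc 1 T, ∀ i, P.map (fun ω => R t ω i) = ν i
  /-- The rewards of round `t` are independent of the past. -/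
  indep_reward : ∀ t ∈ Finset.Icc 1 T,
    Indep (MeasurableSpace.comap (R t) inferInstance) (past R R' I t) P
  /-- The corrupted rewards lie in `[0, 1]`. -/
  corrupted_mem : ∀ t ∈ Finset.Icc 1 T, ∀ ω i, R' t ω i ∈ Set.Icc (0 : ℝ) 1
  /-- Given all that happened before, the player picks arm `i` with the probability computed by
  BARBAR from the arms pulled so far and their observed corrupted rewards. -/
  choice : ∀ t ∈ Finset.Icc 1 T, ∀ i,
    P⟦I t ⁻¹' {i} | beforeChoice R R' I t⟧ =ᵐ[P]
      fun ω => barbarProb δ T (fun s => I s ω) (fun s => R' s ω (I s ω)) t i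

/-- The mean `μᵢ` of the reward distribution of arm `i`. -/
def mean {K : ℕ} (ν : Fin K → Measure ℝ) (i : Fin K) : ℝ := ∫ y, y ∂(ν i)

/-- The gap `Δᵢ = μ⋆ - μᵢ`, where `istar` is the best arm. -/
def gap {K : ℕ} (ν : Fin K → Measure ℝ) (istar i : Fin K) : ℝ := mean ν istar - mean ν i

/-- The pseudo-regret `∑_{t=1}^T (μ⋆ - μ_{i_t})`. -/
def regret {K : ℕ} {Ω : Type*} (ν : Fin K → Measure ℝ) (istar : Fin K) (T : ℕ)
    (I : ℕ → Ω → Fin K) (ω : Ω) : ℝ :=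
  ∑ t ∈ Finset.Icc 1 T, (mean ν istar - mean ν (I t ω))

/-- The total corruption `C = ∑_{t=1}^T ‖R'ᵗ - Rᵗ‖_∞` (the norm of `Fin K → ℝ` is the sup norm). -/
def corruption {K : ℕ} {Ω : Type*} (T : ℕ) (R R' : ℕ → Ω → Fin K → ℝ) (ω : Ω) : ℝ :=
  ∑ t ∈ Finset.Icc 1 T, ‖R' t ω - R t ω‖

end CorruptedBandit

end

/-!
BARBAR never learns how much corruption there is; it estimates the gaps afresh in every epoch, from
an amount of data that corruption can only spoil in proportion to its share of the epoch.

*Concentration.* Fix an arm and an epoch. The epoch and its gap estimates are determined by the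
rounds before it (`state_congr`), so cutting any sum over rounds off outside the epoch is a
predictable operation, and no stopping time is needed. For a predictable parameter `θ` the process
`exp (∑ (θ Y u - q v (e^θ - 1)))`, with `Y` the indicator of a pull and `q` its conditional
probability, is a supermartingale in two cases: `u = v` is fixed before the player chooses
(`IsBarbarRun.integral_mul_exp_choice_le`), or `u` is the reward of the arm and `v` its mean
(`IsBarbarRun.integral_mul_exp_reward_le`). Markov's inequality and a union bound over the arms and
the at most `log₂ T` epochs that start before the horizon give an event of probability at least
`1 - δ` on which the average reward of each arm in a complete epoch is within
`2 C / N + Δᵢ / 16` of its mean, where `C` is the corruption and `N` the length of the epoch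
(`GoodPath.abs_avg_sub_le`), and on which no arm is pulled much more often than planned
(`GoodPath.count_le`).

*Regret.* On this event the gap estimates are compared with the true gaps by induction over the
epochs (`GoodPath.gap_le`, `GoodPath.le_gap`), up to the resolution `2⁻ʲ` of the epoch and the sum
`discountedCorr` of the corruption rates `2 C / N` of the earlier epochs, discounted geometrically.
Thus an arm with gap `Δ` costs at most a constant times `λ / Δ` in an epoch, plus a term
proportional to `λ 4ʲ` times the discounted corruption (`GoodPath.count_mul_gap_le`). As the length
of an epoch is at least `λ 4ʲ`, while the discount factor is `1 / 8`, the latter terms sum to a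
constant times the total corruption, once for each arm (`GoodPath.sum_discountedCorr_le`).

The bound in expectation follows with `δ = 1 / T`, since the regret never exceeds `T`.
-/

namespace CorruptedBandit

/-! ### Deterministic properties of the epoch schedule -/

section Schedule

variable {K : ℕ} {l : ℝ} {a : ℕ → Fin K} {x : ℕ → ℝ}

lemma inv_two_pow_le_state_gap (j : ℕ) (i : Fin K) : (2⁻¹ : ℝ) ^ j ≤ (state l a x j).gap i := by
  cases j with
  | zero => simp [state]
  | succ j => exact le_max_left _ _

lemma state_gap_pos (j : ℕ) (i : Fin K) : 0 < (state l a x j).gap i :=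
  lt_of_lt_of_le (by positivity) (inv_two_pow_le_state_gap j i)

lemma state_pulls_pos (hl : 0 < l) (j : ℕ) (i : Fin K) : 0 < (state l a x j).pulls l i :=
  div_pos hl (pow_pos (state_gap_pos j i) 2)

lemma state_pulls_mul_sq (j : ℕ) (i : Fin K) :
    (state l a x j).pulls l i * (state l a x j).gap i ^ 2 = l :=
  div_mul_cancel₀ _ (pow_pos (state_gap_pos j i) 2).ne'

lemma state_pulls_le (hl : 0 < l) (j : ℕ) (i : Fin K) :
    (state l a x j).pulls l i ≤ l * 4 ^ j := by
  unfold EpochState.pulls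
  rw [div_le_iff₀ (pow_pos (state_gap_pos j i) 2)]
  have h := pow_le_pow_left₀ (by positivity) (inv_two_pow_le_state_gap (l := l) (a := a) (x := x) j i) 2
  have h4 : (4 : ℝ) ^ j * ((2⁻¹ : ℝ) ^ j) ^ 2 = 1 := by
    rw [← pow_mul, mul_comm j 2, pow_mul, ← mul_pow]; norm_num
  have := mul_le_mul_of_nonneg_left h (by positivity : (0 : ℝ) ≤ l * 4 ^ j)
  calc l = l * (4 ^ j * ((2⁻¹ : ℝ) ^ j) ^ 2) := by rw [h4, mul_one]
    _ ≤ _ := by linarith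

lemma state_pulls_le_length (hl : 0 < l) (j : ℕ) (i : Fin K) :
    (state l a x j).pulls l i ≤ (state l a x j).length l :=
  Finset.single_le_sum (f := fun i => (state l a x j).pulls l i)
    (fun i _ => (state_pulls_pos hl j i).le) (Finset.mem_univ i)

/-- The arm that attains the maximum `r⋆` keeps the smallest admissible gap estimate. -/
lemma exists_state_gap_eq [Nonempty (Fin K)] (j : ℕ) :
    ∃ i, (state l a x j).gap i = (2⁻¹ : ℝ) ^ j := by
  cases j with
  | zero => exact ⟨Classical.arbitrary _, by simp [state]⟩
  | succ j =>
    obtain ⟨i, hi⟩ := exists_eq_ciSup_of_finite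
      (f := fun i => (state l a x j).avg l a x i - (state l a x j).gap i / 16)
    refine ⟨i, max_eq_left ?_⟩
    have h : (state l a x j).best l a x
        = (state l a x j).avg l a x i - (state l a x j).gap i / 16 := hi.symm
    rw [h]
    have := state_gap_pos (l := l) (a := a) (x := x) j i
    have : (0 : ℝ) < 2⁻¹ ^ (j + 1) := by positivity
    linarith

lemma le_state_length [Nonempty (Fin K)] (hl : 0 < l) (j : ℕ) :
    l * 4 ^ j ≤ (state l a x j).length l := by
  obtain ⟨i, hi⟩ := exists_state_gap_eq (l := l) (a := a) (x := x) j
  refine le_trans (le_of_eq ?_) (state_pulls_le_length hl j i)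
  rw [EpochState.pulls, hi, ← pow_mul, mul_comm j 2, pow_mul, div_eq_mul_inv, ← inv_pow]
  norm_num

lemma state_length_pos [Nonempty (Fin K)] (hl : 0 < l) (j : ℕ) :
    0 < (state l a x j).length l :=
  lt_of_lt_of_le (by positivity) (le_state_length hl j)

lemma state_time_succ (j : ℕ) :
    (state l a x (j + 1)).time = (state l a x j).time + (state l a x j).length l := rfl

lemma strictMono_state_time [Nonempty (Fin K)] (hl : 0 < l) :
    StrictMono fun j => (state l a x j).time :=
  strictMono_nat_of_lt_succ fun j => by
    rw [state_time_succ]; linarith [state_length_pos (a := a) (x := x) hl j]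

lemma state_time_nonneg [Nonempty (Fin K)] (hl : 0 < l) (j : ℕ) : 0 ≤ (state l a x j).time :=
  (strictMono_state_time hl).monotone (Nat.zero_le j)

/-- The epochs grow so fast that the first `T` rounds meet at most `log₂ T` of them. -/
lemma two_pow_le_of_state_time_lt [Nonempty (Fin K)] (hl : 4 ≤ l) {T : ℕ} (hT : 2 ≤ T) {j : ℕ}
    (hj : (state l a x j).time < T) : 2 ^ (j + 1) ≤ T := by
  cases j with
  | zero => simpa using hT
  | succ j =>
    have hl0 : 0 < l := by linarith
    rw [state_time_succ] at hj
    have h1 := le_state_length (a := a) (x := x) hl0 j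
    have h2 := state_time_nonneg (a := a) (x := x) hl0 j
    have h3 : (4 : ℝ) * 4 ^ j ≤ l * 4 ^ j := mul_le_mul_of_nonneg_right hl (by positivity)
    have h4 : (2 : ℝ) ^ (j + 1 + 1) ≤ 4 * 4 ^ j := by
      have : (2 : ℝ) ^ j ≤ 4 ^ j := pow_le_pow_left₀ (by norm_num) (by norm_num) j
      rw [pow_succ, pow_succ]; linarith
    have : ((2 ^ (j + 1 + 1) : ℕ) : ℝ) ≤ T := by push_cast; linarith
    exact_mod_cast this

lemma lt_log_of_state_time_lt [Nonempty (Fin K)] (hl : 4 ≤ l) {T : ℕ} (hT : 2 ≤ T) {j : ℕ}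
    (hj : (state l a x j).time < T) : j < Nat.log 2 T :=
  Nat.le_log_of_pow_le (by norm_num) (two_pow_le_of_state_time_lt hl hT hj)

/-- Round `t` belongs to the epoch that follows the state after `j` epochs. Epochs are thus counted
from `0`: this is epoch `j + 1` of the algorithm. -/
def InEpoch (l : ℝ) (a : ℕ → Fin K) (x : ℕ → ℝ) (j t : ℕ) : Prop :=
  (state l a x j).time < t ∧ (t : ℝ) ≤ (state l a x (j + 1)).time

noncomputable instance (l : ℝ) (a : ℕ → Fin K) (x : ℕ → ℝ) (j : ℕ) :
    DecidablePred (InEpoch l a x j) := Classical.decPred _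

lemma InEpoch.eq [Nonempty (Fin K)] (hl : 0 < l) {j k t : ℕ} (hj : InEpoch l a x j t)
    (hk : InEpoch l a x k t) : j = k := by
  have hm := strictMono_state_time (a := a) (x := x) hl
  have h1 : j < k + 1 := hm.lt_iff_lt.1 (lt_of_lt_of_le hj.1 hk.2)
  have h2 : k < j + 1 := hm.lt_iff_lt.1 (lt_of_lt_of_le hk.1 hj.2)
  omega

lemma InEpoch.epoch_eq [Nonempty (Fin K)] (hl : 0 < l) {j t : ℕ} (hj : InEpoch l a x j t) :
    epoch l a x t = j + 1 := by
  apply le_antisymm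
  · exact Nat.sInf_le hj.2
  · refine le_csInf ⟨_, hj.2⟩ fun m hm => ?_
    have := (strictMono_state_time (a := a) (x := x) hl).lt_iff_lt.1
      (lt_of_lt_of_le hj.1 hm)
    omega

lemma exists_inEpoch [Nonempty (Fin K)] (hl : 4 ≤ l) {T t : ℕ} (hT : 2 ≤ T)
    (ht : t ∈ Finset.Icc 1 T) : ∃ j < Nat.log 2 T, InEpoch l a x j t := by
  rw [Finset.mem_Icc] at ht
  have hex : ∃ m, (t : ℝ) ≤ (state l a x m).time := by
    by_contra! h
    refine lt_irrefl _ (lt_log_of_state_time_lt (a := a) (x := x) (j := Nat.log 2 T) hl hT ?_)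
    exact (h _).trans_le (by exact_mod_cast ht.2)
  classical
  have hspec := Nat.find_spec hex
  have hmin := fun m => Nat.find_min hex (m := m)
  rcases h : Nat.find hex with _ | j
  · rw [h] at hspec
    have : (1 : ℝ) ≤ t := by exact_mod_cast ht.1
    simp only [state] at hspec
    linarith
  · rw [h] at hspec
    have hj : (state l a x j).time < t := not_le.1 (hmin j (by omega))
    exact ⟨j, lt_log_of_state_time_lt hl hT (hj.trans_le (by exact_mod_cast ht.2)), hj, hspec⟩

lemma InEpoch.barbarProb_eq [Nonempty (Fin K)] {δ : ℝ} {T : ℕ} (hl : 0 < lam K δ T) {j t : ℕ}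
    (hj : InEpoch (lam K δ T) a x j t) (i : Fin K) :
    barbarProb δ T a x t i =
      (state (lam K δ T) a x j).pulls (lam K δ T) i / (state (lam K δ T) a x j).length (lam K δ T) := by
  simp only [barbarProb, hj.epoch_eq hl, Nat.add_sub_cancel]

/-- The state at the beginning of an epoch is determined by what is observed strictly before any
round of that epoch. -/
lemma state_congr [Nonempty (Fin K)] (hl : 0 < l) {a' : ℕ → Fin K} {x' : ℕ → ℝ} {t : ℕ}
    (ha : ∀ s ∈ Finset.Ico 1 t, a s = a' s) (hx : ∀ s ∈ Finset.Ico 1 t, x s = x' s) (j : ℕ)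
    (hj : (state l a x j).time < t) : state l a x j = state l a' x' j := by
  induction j with
  | zero => rfl
  | succ j ih =>
    have hs := ih (((strictMono_state_time hl) (Nat.lt_succ_self j)).trans hj)
    have havg : (state l a x j).avg l a x = (state l a x j).avg l a' x' := by
      funext i
      unfold EpochState.avg
      congr 1
      refine Finset.sum_congr rfl fun s hs' => ?_
      rw [Finset.mem_Ioc] at hs'
      have h1 : (s : ℝ) ≤ (state l a x (j + 1)).time :=
        (Nat.le_floor_iff (state_time_nonneg (a := a) (x := x) hl (j + 1))).1 hs'.2
      have h2 : s < t := by exact_mod_cast h1.trans_lt hj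
      have hmem : s ∈ Finset.Ico 1 t := Finset.mem_Ico.2 ⟨by omega, h2⟩
      rw [ha s hmem, hx s hmem]
    have hbest : (state l a x j).best l a x = (state l a x j).best l a' x' := by
      unfold EpochState.best; rw [havg]
    rw [state, state, hbest, havg, hs]

lemma inEpoch_congr [Nonempty (Fin K)] (hl : 0 < l) {a' : ℕ → Fin K} {x' : ℕ → ℝ} {t : ℕ}
    (ha : ∀ s ∈ Finset.Ico 1 t, a s = a' s) (hx : ∀ s ∈ Finset.Ico 1 t, x s = x' s) (j : ℕ) :
    InEpoch l a x j t ↔ InEpoch l a' x' j t := by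
  constructor
  · intro h
    have hs := state_congr hl ha hx j h.1
    simpa only [InEpoch, state_time_succ, ← hs] using h
  · intro h
    have hs := state_congr hl (fun s m => (ha s m).symm) (fun s m => (hx s m).symm) j h.1
    simpa only [InEpoch, state_time_succ, ← hs] using h

end Schedule

section Measurability

variable {K : ℕ} (l : ℝ)

lemma measurable_sum_Ioc_floor {α : Type*} [MeasurableSpace α] {u v : α → ℝ} {f : ℕ → α → ℝ}
    (hu : Measurable u) (hv : Measurable v) (hf : ∀ t, Measurable (f t)) :
    Measurable fun h => ∑ t ∈ Finset.Ioc ⌊u h⌋₊ ⌊v h⌋₊, f t h := by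
  have h1 : Measurable fun p : (ℕ × ℕ) × α => ∑ t ∈ Finset.Ioc p.1.1 p.1.2, f t p.2 :=
    measurable_from_prod_countable_right fun p => by
      simpa only using Finset.measurable_fun_sum (Finset.Ioc p.1 p.2) fun t _ => hf t
  exact h1.comp (((Nat.measurable_floor.comp hu).prodMk (Nat.measurable_floor.comp hv)).prodMk
    measurable_id)

/-- The gap estimates and epoch ends are measurable functions of the observed history. -/
lemma measurable_state (j : ℕ) :
    (∀ i, Measurable fun h : (ℕ → Fin K) × (ℕ → ℝ) => (state l h.1 h.2 j).gap i) ∧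
      Measurable fun h : (ℕ → Fin K) × (ℕ → ℝ) => (state l h.1 h.2 j).time := by
  induction j with
  | zero => exact ⟨fun i => measurable_const, measurable_const⟩
  | succ j ih =>
    obtain ⟨hg, ht⟩ := ih
    have hp : ∀ i, Measurable fun h : (ℕ → Fin K) × (ℕ → ℝ) => (state l h.1 h.2 j).pulls l i :=
      fun i => ((hg i).pow_const 2).const_div l
    have hN : Measurable fun h : (ℕ → Fin K) × (ℕ → ℝ) => (state l h.1 h.2 j).length l :=
      Finset.measurable_sum _ fun i _ => hp i
    have havg : ∀ i, Measurable fun h : (ℕ → Fin K) × (ℕ → ℝ) =>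
        (state l h.1 h.2 j).avg l h.1 h.2 i := by
      intro i
      refine Measurable.div (measurable_sum_Ioc_floor ht (ht.add hN) fun t => ?_) (hp i)
      refine Measurable.ite ?_ ((measurable_pi_apply t).comp measurable_snd) measurable_const
      have ha : Measurable fun h : (ℕ → Fin K) × (ℕ → ℝ) => h.1 t :=
        (measurable_pi_apply t).comp measurable_fst
      exact ha (measurableSet_singleton i)
    have hbest : Measurable fun h : (ℕ → Fin K) × (ℕ → ℝ) =>
        (state l h.1 h.2 j).best l h.1 h.2 :=
      Measurable.iSup fun i => (havg i).sub ((hg i).div_const 16)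
    exact ⟨fun i => measurable_const.max (hbest.sub (havg i)), ht.add hN⟩

lemma measurable_state_pulls (j : ℕ) (i : Fin K) :
    Measurable fun h : (ℕ → Fin K) × (ℕ → ℝ) => (state l h.1 h.2 j).pulls l i :=
  (((measurable_state l j).1 i).pow_const 2).const_div l

lemma measurable_state_length (j : ℕ) :
    Measurable fun h : (ℕ → Fin K) × (ℕ → ℝ) => (state l h.1 h.2 j).length l :=
  Finset.measurable_sum _ fun i _ => measurable_state_pulls l j i

lemma measurableSet_inEpoch (j t : ℕ) :
    MeasurableSet {h : (ℕ → Fin K) × (ℕ → ℝ) | InEpoch l h.1 h.2 j t} :=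
  (measurableSet_lt (measurable_state l j).2 measurable_const).inter
    (measurableSet_le measurable_const (measurable_state l (j + 1)).2)

end Measurability

/-! ### Exponential supermartingales along the run -/

section Filtration

variable {K : ℕ} {Ω : Type*} {R R' : ℕ → Ω → Fin K → ℝ} {I : ℕ → Ω → Fin K}

lemma past_mono {s t : ℕ} (h : s ≤ t) : past R R' I s ≤ past R R' I t :=
  biSup_mono fun _ hu => Finset.mem_Ico.2 ⟨(Finset.mem_Ico.1 hu).1, (Finset.mem_Ico.1 hu).2.trans_le h⟩

lemma past_le_beforeChoice (t : ℕ) : past R R' I t ≤ beforeChoice R R' I t := le_sup_left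

lemma comap_round_le_past {s t : ℕ} (hs : s ∈ Finset.Ico 1 t) :
    MeasurableSpace.comap (R s) inferInstance ⊔ MeasurableSpace.comap (R' s) inferInstance ⊔
      MeasurableSpace.comap (I s) inferInstance ≤ past R R' I t :=
  le_iSup₂ (f := fun s (_ : s ∈ Finset.Ico 1 t) =>
    MeasurableSpace.comap (R s) inferInstance ⊔ MeasurableSpace.comap (R' s) inferInstance ⊔
      MeasurableSpace.comap (I s) inferInstance) s hs

lemma beforeChoice_le_past_succ {t : ℕ} (ht : 1 ≤ t) :
    beforeChoice R R' I t ≤ past R R' I (t + 1) :=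
  sup_le (past_mono (Nat.le_succ t))
    (le_sup_left.trans (comap_round_le_past (Finset.mem_Ico.2 ⟨ht, Nat.lt_succ_self t⟩)))

lemma measurable_past_corrupted {s t : ℕ} (hs : s ∈ Finset.Ico 1 t) :
    Measurable[past R R' I t] (R' s) :=
  Measurable.mono (comap_measurable (R' s))
    ((le_sup_right.trans le_sup_left).trans (comap_round_le_past hs)) le_rfl

lemma measurable_past_arm {s t : ℕ} (hs : s ∈ Finset.Ico 1 t) :
    Measurable[past R R' I t] (I s) :=
  Measurable.mono (comap_measurable (I s))
    (le_sup_right.trans (comap_round_le_past hs)) le_rfl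

lemma measurable_beforeChoice_reward (t : ℕ) : Measurable[beforeChoice R R' I t] (R t) :=
  Measurable.mono (comap_measurable (R t)) (le_sup_left.trans le_sup_right) le_rfl

lemma measurable_beforeChoice_corrupted (t : ℕ) : Measurable[beforeChoice R R' I t] (R' t) :=
  Measurable.mono (comap_measurable (R' t)) (le_sup_right.trans le_sup_right) le_rfl

/-- The feedback of a round, as a measurable function of the corrupted rewards and the arm. -/
lemma measurable_eval_arm {m : MeasurableSpace Ω} {V : Ω → Fin K → ℝ} {J : Ω → Fin K}
    (hV : Measurable V) (hJ : Measurable J) : Measurable fun ω => V ω (J ω) := by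
  have h : Measurable fun p : Fin K × (Fin K → ℝ) => p.2 p.1 :=
    measurable_from_prod_countable_right fun i => measurable_pi_apply i
  exact h.comp (hJ.prodMk hV)

/-- A measurable function of the observed history that only looks at the rounds before `t` is
measurable with respect to the past of round `t`. -/
lemma measurable_past_of_causal [Nonempty (Fin K)] {t : ℕ} {F : (ℕ → Fin K) → (ℕ → ℝ) → ℝ}
    (hF : Measurable fun h : (ℕ → Fin K) × (ℕ → ℝ) => F h.1 h.2)
    (hcausal : ∀ a a' x x', (∀ s ∈ Finset.Ico 1 t, a s = a' s) →
      (∀ s ∈ Finset.Ico 1 t, x s = x' s) → F a x = F a' x') :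
    Measurable[past R R' I t] fun ω => F (fun s => I s ω) (fun s => R' s ω (I s ω)) := by
  have hA : Measurable[past R R' I t] fun ω => fun s : ℕ =>
      if s ∈ Finset.Ico 1 t then I s ω else Classical.arbitrary (Fin K) := by
    refine @measurable_pi_lambda _ _ _ (past R R' I t) _ _ fun s => ?_
    by_cases hs : s ∈ Finset.Ico 1 t
    · simpa only [hs, if_true] using measurable_past_arm hs
    · simp only [hs, if_false]; exact measurable_const
  have hX : Measurable[past R R' I t] fun ω => fun s : ℕ =>
      if s ∈ Finset.Ico 1 t then R' s ω (I s ω) else 0 := by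
    refine @measurable_pi_lambda _ _ _ (past R R' I t) _ _ fun s => ?_
    by_cases hs : s ∈ Finset.Ico 1 t
    · simpa only [hs, if_true] using
        measurable_eval_arm (measurable_past_corrupted hs) (measurable_past_arm hs)
    · simp only [hs, if_false]; exact measurable_const
  have h := hF.comp (Measurable.prodMk (m := past R R' I t) hA hX)
  refine Eq.mp ?_ h
  congr 1
  funext ω
  refine hcausal _ _ _ _ (fun s hs => ?_) (fun s hs => ?_) <;> simp only [hs, if_true]

/-- Quantities that BARBAR fixes at the beginning of an epoch, cut off outside that epoch, are
predictable. -/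
lemma measurable_past_inEpoch [Nonempty (Fin K)] {l : ℝ} (hl : 0 < l) (j t : ℕ)
    {G : EpochState K → ℝ}
    (hG : Measurable fun h : (ℕ → Fin K) × (ℕ → ℝ) => G (state l h.1 h.2 j)) :
    Measurable[past R R' I t] fun ω =>
      if InEpoch l (fun s => I s ω) (fun s => R' s ω (I s ω)) j t then
        G (state l (fun s => I s ω) (fun s => R' s ω (I s ω)) j) else 0 := by
  refine measurable_past_of_causal
    (F := fun a x => if InEpoch l a x j t then G (state l a x j) else 0)
    (Measurable.ite (measurableSet_inEpoch l j t) hG measurable_const) ?_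
  intro a a' x x' ha hx
  by_cases h : InEpoch l a x j t
  · have h' := (inEpoch_congr hl ha hx j).1 h
    simp only [h, h', if_true, state_congr hl ha hx j h.1]
  · have h' := mt (inEpoch_congr hl ha hx j).2 h
    simp only [h, h', if_false]

/-- The indicator that arm `i` is pulled. -/
def pulled (I : ℕ → Ω → Fin K) (i : Fin K) (t : ℕ) (ω : Ω) : ℝ := if I t ω = i then 1 else 0

lemma pulled_eq_indicator (i : Fin K) (t : ℕ) :
    pulled I i t = (I t ⁻¹' {i}).indicator fun _ => (1 : ℝ) := by
  funext ω; simp [pulled, Set.indicator]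

lemma measurable_pulled {m : MeasurableSpace Ω} {i : Fin K} {t : ℕ} (h : Measurable[m] (I t)) :
    Measurable[m] (pulled I i t) := by
  rw [pulled_eq_indicator]
  exact measurable_const.indicator (h (measurableSet_singleton i))

lemma abs_pulled_le (i : Fin K) (t : ℕ) (ω : Ω) : |pulled I i t ω| ≤ 1 := by
  unfold pulled; split_ifs <;> simp

end Filtration

section Supermartingale

variable {K : ℕ} {Ω : Type*} [MeasurableSpace Ω] {P : Measure Ω} {ν : Fin K → Measure ℝ} {δ : ℝ}
  {T : ℕ} {R R' : ℕ → Ω → Fin K → ℝ} {I : ℕ → Ω → Fin K}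

lemma IsBarbarRun.past_le (h : IsBarbarRun P ν δ T R R' I) {t : ℕ} (ht : t ≤ T + 1) :
    past R R' I t ≤ ‹MeasurableSpace Ω› := by
  refine iSup₂_le fun s hs => ?_
  have hs' : s ∈ Finset.Icc 1 T := by
    rw [Finset.mem_Ico] at hs; rw [Finset.mem_Icc]; omega
  exact sup_le (sup_le (h.measurable_reward s hs').comap_le (h.measurable_corrupted s hs').comap_le)
    (h.measurable_arm s hs').comap_le

lemma IsBarbarRun.beforeChoice_le (h : IsBarbarRun P ν δ T R R' I) {t : ℕ}
    (ht : t ∈ Finset.Icc 1 T) : beforeChoice R R' I t ≤ ‹MeasurableSpace Ω› :=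
  (beforeChoice_le_past_succ (Finset.mem_Icc.1 ht).1).trans
    (h.past_le (Nat.succ_le_succ (Finset.mem_Icc.1 ht).2))

/-- Integrating against the choice of the player replaces the indicator of a pull by its
conditional probability. -/
lemma IsBarbarRun.integral_mul_pulled [IsProbabilityMeasure P] (h : IsBarbarRun P ν δ T R R' I)
    {t : ℕ} (ht : t ∈ Finset.Icc 1 T) (i : Fin K) {g q : Ω → ℝ} {B : ℝ}
    (hg : Measurable[beforeChoice R R' I t] g) (hB : ∀ ω, |g ω| ≤ B)
    (hq : ∀ ω, g ω ≠ 0 → barbarProb δ T (fun s => I s ω) (fun s => R' s ω (I s ω)) t i = q ω) :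
    ∫ ω, g ω * pulled I i t ω ∂P = ∫ ω, g ω * q ω ∂P := by
  have hm := h.beforeChoice_le ht
  have hY : Measurable (pulled I i t) := measurable_pulled (h.measurable_arm t ht)
  have hYi : Integrable (pulled I i t) P :=
    Integrable.of_bound hY.aestronglyMeasurable 1 (ae_of_all _ fun ω => abs_pulled_le i t ω)
  have hgY : Integrable (g * pulled I i t) P := by
    refine Integrable.of_bound ((hg.mono hm le_rfl).mul hY).aestronglyMeasurable B
      (ae_of_all _ fun ω => ?_)
    rw [Pi.mul_apply, norm_mul]
    calc ‖g ω‖ * ‖pulled I i t ω‖ ≤ B * 1 :=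
          mul_le_mul (hB ω) (abs_pulled_le i t ω) (norm_nonneg _) ((abs_nonneg _).trans (hB ω))
      _ = B := mul_one B
  have hce := condExp_mul_of_stronglyMeasurable_left (m := beforeChoice R R' I t)
    hg.stronglyMeasurable hgY hYi
  have hch := h.choice t ht i
  rw [← pulled_eq_indicator] at hch
  calc ∫ ω, g ω * pulled I i t ω ∂P
      = ∫ ω, (P[g * pulled I i t | beforeChoice R R' I t]) ω ∂P := (integral_condExp hm).symm
    _ = ∫ ω, g ω * q ω ∂P := by
        refine integral_congr_ae ?_
        filter_upwards [hce, hch] with ω h1 h2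
        rw [h1, Pi.mul_apply, h2]
        by_cases h0 : g ω = 0
        · simp [h0]
        · rw [hq ω h0]

lemma exp_mul_sub_one_le {θ c : ℝ} (h0 : 0 ≤ c) (h1 : c ≤ 1) :
    Real.exp (θ * c) - 1 ≤ c * (Real.exp θ - 1) := by
  have h := convexOn_exp.2 (Set.mem_univ θ) (Set.mem_univ 0) h0 (by linarith : 0 ≤ 1 - c) (by ring)
  simp only [smul_eq_mul, mul_zero, add_zero, Real.exp_zero, mul_one] at h
  rw [mul_comm θ c]; linarith

lemma abs_exp_sub_one_le_two {θ : ℝ} (h : |θ| ≤ 1) : |Real.exp θ - 1| ≤ 2 := by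
  have := Real.abs_exp_sub_one_le h; linarith

lemma exp_le_exp_two {u : ℝ} (h : |u| ≤ 2) : Real.exp (-u) ≤ Real.exp 2 :=
  Real.exp_le_exp.2 (by linarith [neg_abs_le u])

lemma abs_prod₃_le {q v e : ℝ} (hq0 : 0 ≤ q) (hq1 : q ≤ 1) (hv0 : 0 ≤ v) (hv1 : v ≤ 1)
    (he : |e| ≤ 2) : |q * v * e| ≤ 2 := by
  rw [abs_mul, abs_of_nonneg (mul_nonneg hq0 hv0)]
  nlinarith [mul_le_one₀ hq1 hv0 hv1, abs_nonneg e, mul_nonneg hq0 hv0]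

/-- The analytic core of both one-step bounds: an arm pulled with probability `q`, whose reward
has conditional mean at most `v`, contributes a factor at most `exp (q v (e^θ - 1))`. -/
lemma exp_neg_mul_one_add_le {q v e : ℝ} : Real.exp (-(q * v * e)) * (1 + q * (v * e)) ≤ 1 := by
  have h := Real.add_one_le_exp (q * v * e)
  calc _ ≤ Real.exp (-(q * v * e)) * Real.exp (q * v * e) :=
        mul_le_mul_of_nonneg_left (by linarith) (Real.exp_pos _).le
    _ = 1 := by rw [← Real.exp_add]; simp

/-- The player's randomization, tested against quantities `c` that are fixed before the choice. -/
lemma IsBarbarRun.integral_mul_exp_choice_le [IsProbabilityMeasure P]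
    (h : IsBarbarRun P ν δ T R R' I)
    {t : ℕ} (ht : t ∈ Finset.Icc 1 T) (i : Fin K) {f θ q c : Ω → ℝ} {B : ℝ}
    (hf : Measurable[past R R' I t] f) (hf0 : ∀ ω, 0 ≤ f ω) (hfB : ∀ ω, f ω ≤ B)
    (hθ : Measurable[past R R' I t] θ) (hθ1 : ∀ ω, |θ ω| ≤ 1)
    (hqm : Measurable[past R R' I t] q) (hq0 : ∀ ω, 0 ≤ q ω) (hq1 : ∀ ω, q ω ≤ 1)
    (hq : ∀ ω, θ ω ≠ 0 → barbarProb δ T (fun s => I s ω) (fun s => R' s ω (I s ω)) t i = q ω)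
    (hc : Measurable[beforeChoice R R' I t] c) (hc0 : ∀ ω, 0 ≤ c ω) (hc1 : ∀ ω, c ω ≤ 1) :
    ∫ ω, f ω * Real.exp (θ ω * (pulled I i t ω * c ω) - q ω * c ω * (Real.exp (θ ω) - 1)) ∂P ≤
      ∫ ω, f ω ∂P := by
  have hm := h.beforeChoice_le ht
  have hp := past_le_beforeChoice (R := R) (R' := R') (I := I) t
  replace hf := hf.mono hp le_rfl
  replace hθ := hθ.mono hp le_rfl
  replace hqm := hqm.mono hp le_rfl
  set k : Ω → ℝ := fun ω => Real.exp (-(q ω * c ω * (Real.exp (θ ω) - 1))) with hk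
  have hkm : Measurable[beforeChoice R R' I t] k :=
    Real.measurable_exp.comp ((hqm.mul hc).mul ((Real.measurable_exp.comp hθ).sub_const 1)).neg
  have hk0 : ∀ ω, 0 ≤ k ω := fun ω => (Real.exp_pos _).le
  have hkB : ∀ ω, k ω ≤ Real.exp 2 := fun ω => exp_le_exp_two
    (abs_prod₃_le (hq0 ω) (hq1 ω) (hc0 ω) (hc1 ω) (abs_exp_sub_one_le_two (hθ1 ω)))
  have hfk : ∀ ω, |f ω * k ω| ≤ B * Real.exp 2 := fun ω => by
    rw [abs_of_nonneg (mul_nonneg (hf0 ω) (hk0 ω))]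
    exact mul_le_mul (hfB ω) (hkB ω) (hk0 ω) ((hf0 ω).trans (hfB ω))
  have he2 : ∀ ω, |Real.exp (θ ω * c ω) - 1| ≤ 2 := fun ω => by
    refine abs_exp_sub_one_le_two ?_
    rw [abs_mul, abs_of_nonneg (hc0 ω)]
    exact mul_le_one₀ (hθ1 ω) (hc0 ω) (hc1 ω)
  set g : Ω → ℝ := fun ω => f ω * k ω * (Real.exp (θ ω * c ω) - 1) with hg
  have hgm : Measurable[beforeChoice R R' I t] g :=
    (hf.mul hkm).mul ((Real.measurable_exp.comp (hθ.mul hc)).sub_const 1)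
  have hgB : ∀ ω, |g ω| ≤ B * Real.exp 2 * 2 := fun ω => by
    rw [hg, abs_mul]
    exact mul_le_mul (hfk ω) (he2 ω) (abs_nonneg _) ((abs_nonneg _).trans (hfk ω))
  have hfki : Integrable (fun ω => f ω * k ω) P :=
    Integrable.of_bound ((hf.mul hkm).mono hm le_rfl).aestronglyMeasurable _ (ae_of_all _ hfk)
  have hgi : ∀ {y : Ω → ℝ}, Measurable y → (∀ ω, |y ω| ≤ 1) →
      Integrable (fun ω => g ω * y ω) P := fun {y} hy hy1 => by
    refine Integrable.of_bound ((hgm.mono hm le_rfl).mul hy).aestronglyMeasurable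
      (B * Real.exp 2 * 2) (ae_of_all _ fun ω => ?_)
    rw [norm_mul]
    calc ‖g ω‖ * ‖y ω‖ ≤ (B * Real.exp 2 * 2) * 1 :=
          mul_le_mul (hgB ω) (hy1 ω) (norm_nonneg _) ((abs_nonneg _).trans (hgB ω))
      _ = _ := mul_one _
  have hgY := hgi (measurable_pulled (i := i) (h.measurable_arm t ht)) (abs_pulled_le i t)
  have hgq := hgi (hqm.mono hm le_rfl) fun ω => by
    rw [abs_of_nonneg (hq0 ω)]; exact hq1 ω
  have hfi : Integrable f P := Integrable.of_bound (hf.mono hm le_rfl).aestronglyMeasurable B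
    (ae_of_all _ fun ω => by rw [Real.norm_eq_abs, abs_of_nonneg (hf0 ω)]; exact hfB ω)
  calc _ = ∫ ω, (f ω * k ω + g ω * pulled I i t ω) ∂P := by
        refine integral_congr_ae (ae_of_all _ fun ω => ?_)
        have : Real.exp (θ ω * (pulled I i t ω * c ω)) =
            1 + (Real.exp (θ ω * c ω) - 1) * pulled I i t ω := by
          unfold pulled; split_ifs <;> simp
        simp only [hg, hk, sub_eq_add_neg (θ ω * _), Real.exp_add, this]
        ring
    _ = ∫ ω, (f ω * k ω + g ω * q ω) ∂P := by
        rw [integral_add hfki hgY, integral_add hfki hgq,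
          h.integral_mul_pulled ht i hgm hgB fun ω hω => hq ω fun h0 => hω (by simp [hg, h0])]
    _ ≤ ∫ ω, f ω ∂P := by
        refine integral_mono (hfki.add hgq) hfi fun ω => ?_
        have h1 : k ω * (1 + q ω * (Real.exp (θ ω * c ω) - 1)) ≤ 1 := le_trans
          (mul_le_mul_of_nonneg_left (by
            have := mul_le_mul_of_nonneg_left (exp_mul_sub_one_le (θ := θ ω) (hc0 ω) (hc1 ω)) (hq0 ω)
            linarith) (hk0 ω)) exp_neg_mul_one_add_le
        have h2 := mul_le_mul_of_nonneg_left h1 (hf0 ω)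
        simp only [hg]
        linarith

/-- A reward clipped to `[0, 1]`. Almost surely nothing is clipped, but clipped rewards are bounded on
every sample path. -/
def clip (y : ℝ) : ℝ := max 0 (min 1 y)

lemma clip_nonneg (y : ℝ) : 0 ≤ clip y := le_max_left _ _

lemma clip_le_one (y : ℝ) : clip y ≤ 1 := max_le zero_le_one (min_le_left _ _)

lemma measurable_clip : Measurable clip := measurable_const.max (measurable_const.min measurable_id)

lemma clip_of_mem {y : ℝ} (hy : y ∈ Set.Icc (0 : ℝ) 1) : clip y = y := by
  rw [clip, min_eq_right hy.2, max_eq_right hy.1]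

lemma mean_mem_Icc {i : Fin K} [IsProbabilityMeasure (ν i)]
    (hν : ∀ᵐ y ∂(ν i), y ∈ Set.Icc (0 : ℝ) 1) : mean ν i ∈ Set.Icc (0 : ℝ) 1 := by
  refine ⟨integral_nonneg_of_ae (hν.mono fun y hy => hy.1), ?_⟩
  calc mean ν i ≤ ∫ _, (1 : ℝ) ∂(ν i) := by
        refine integral_mono_of_nonneg (hν.mono fun y hy => hy.1) (integrable_const _)
          (hν.mono fun y hy => hy.2)
    _ = 1 := by simp

lemma IsBarbarRun.integral_clip_reward (h : IsBarbarRun P ν δ T R R' I) {i : Fin K}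
    (hν : ∀ᵐ y ∂(ν i), y ∈ Set.Icc (0 : ℝ) 1) {t : ℕ} (ht : t ∈ Finset.Icc 1 T) :
    ∫ ω, clip (R t ω i) ∂P = mean ν i := by
  have hR : Measurable fun ω => R t ω i := (measurable_pi_apply i).comp (h.measurable_reward t ht)
  rw [← integral_map (f := clip) hR.aemeasurable measurable_clip.aestronglyMeasurable,
    h.law_reward t ht i]
  exact integral_congr_ae (hν.mono fun y hy => clip_of_mem hy)

lemma IsBarbarRun.ae_reward_mem (h : IsBarbarRun P ν δ T R R' I)
    (hν : ∀ i, ∀ᵐ y ∂(ν i), y ∈ Set.Icc (0 : ℝ) 1) :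
    ∀ᵐ ω ∂P, ∀ t ∈ Finset.Icc 1 T, ∀ i, R t ω i ∈ Set.Icc (0 : ℝ) 1 := by
  simp only [ae_all_iff]
  intro t ht i
  have hR : Measurable fun ω => R t ω i := (measurable_pi_apply i).comp (h.measurable_reward t ht)
  refine ae_of_ae_map hR.aemeasurable ?_
  rw [h.law_reward t ht i]; exact hν i

/-- The reward of the arm, drawn independently of the past, compared with its mean. -/
lemma IsBarbarRun.integral_mul_exp_reward_le [IsProbabilityMeasure P]
    (h : IsBarbarRun P ν δ T R R' I)
    {t : ℕ} (ht : t ∈ Finset.Icc 1 T) (i : Fin K) [IsProbabilityMeasure (ν i)]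
    (hν : ∀ᵐ y ∂(ν i), y ∈ Set.Icc (0 : ℝ) 1) {f θ q : Ω → ℝ} {B : ℝ}
    (hf : Measurable[past R R' I t] f) (hf0 : ∀ ω, 0 ≤ f ω) (hfB : ∀ ω, f ω ≤ B)
    (hθ : Measurable[past R R' I t] θ) (hθ1 : ∀ ω, |θ ω| ≤ 1)
    (hqm : Measurable[past R R' I t] q) (hq0 : ∀ ω, 0 ≤ q ω) (hq1 : ∀ ω, q ω ≤ 1)
    (hq : ∀ ω, θ ω ≠ 0 → barbarProb δ T (fun s => I s ω) (fun s => R' s ω (I s ω)) t i = q ω) :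
    ∫ ω, f ω * Real.exp (θ ω * (pulled I i t ω * clip (R t ω i)) -
        q ω * mean ν i * (Real.exp (θ ω) - 1)) ∂P ≤ ∫ ω, f ω ∂P := by
  have hm := h.beforeChoice_le ht
  have hp := past_le_beforeChoice (R := R) (R' := R') (I := I) t
  have hpm := hp.trans hm
  obtain ⟨hμ0, hμ1⟩ := mean_mem_Icc hν
  set μ := mean ν i
  set r : Ω → ℝ := fun ω => clip (R t ω i) with hr
  have hr0 : ∀ ω, 0 ≤ r ω := fun ω => clip_nonneg _
  have hr1 : ∀ ω, r ω ≤ 1 := fun ω => clip_le_one _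
  have hrR : Measurable[MeasurableSpace.comap (R t) inferInstance] r :=
    measurable_clip.comp ((measurable_pi_apply i).comp (comap_measurable (R t)))
  have hrm : Measurable[beforeChoice R R' I t] r :=
    hrR.mono (le_sup_left.trans le_sup_right) le_rfl
  set k : Ω → ℝ := fun ω => Real.exp (-(q ω * μ * (Real.exp (θ ω) - 1))) with hk
  have hkm : Measurable[past R R' I t] k :=
    Real.measurable_exp.comp
      ((hqm.mul measurable_const).mul ((Real.measurable_exp.comp hθ).sub_const 1)).neg
  have hk0 : ∀ ω, 0 ≤ k ω := fun ω => (Real.exp_pos _).le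
  have hkB : ∀ ω, k ω ≤ Real.exp 2 := fun ω => exp_le_exp_two
    (abs_prod₃_le (hq0 ω) (hq1 ω) hμ0 hμ1 (abs_exp_sub_one_le_two (hθ1 ω)))
  have hfk0 : ∀ ω, 0 ≤ f ω * k ω := fun ω => mul_nonneg (hf0 ω) (hk0 ω)
  have hfk : ∀ ω, |f ω * k ω| ≤ B * Real.exp 2 := fun ω => by
    rw [abs_of_nonneg (hfk0 ω)]
    exact mul_le_mul (hfB ω) (hkB ω) (hk0 ω) ((hf0 ω).trans (hfB ω))
  have he2 : ∀ ω, |Real.exp (θ ω * r ω) - 1| ≤ 2 := fun ω => by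
    refine abs_exp_sub_one_le_two ?_
    rw [abs_mul, abs_of_nonneg (hr0 ω)]
    exact mul_le_one₀ (hθ1 ω) (hr0 ω) (hr1 ω)
  have bound : ∀ {u : Ω → ℝ}, (∀ ω, |u ω| ≤ 2) → ∀ ω, |f ω * k ω * u ω| ≤ B * Real.exp 2 * 2 :=
    fun hu ω => by
      rw [abs_mul]
      exact mul_le_mul (hfk ω) (hu ω) (abs_nonneg _) ((abs_nonneg _).trans (hfk ω))
  have integ : ∀ {u y : Ω → ℝ}, Measurable u → (∀ ω, |u ω| ≤ 2) → Measurable y →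
      (∀ ω, |y ω| ≤ 1) → Integrable (fun ω => f ω * k ω * u ω * y ω) P := fun hu hu2 hy hy1 => by
    refine Integrable.of_bound ((((hf.mul hkm).mono hpm le_rfl).mul hu).mul hy).aestronglyMeasurable
      (B * Real.exp 2 * 2) (ae_of_all _ fun ω => ?_)
    rw [norm_mul]
    calc _ ≤ (B * Real.exp 2 * 2) * 1 :=
          mul_le_mul (bound hu2 ω) (hy1 ω) (abs_nonneg _) ((abs_nonneg _).trans (bound hu2 ω))
      _ = _ := mul_one _
  have hq1' : ∀ ω, |q ω| ≤ 1 := fun ω => by rw [abs_of_nonneg (hq0 ω)]; exact hq1 ω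
  have hr1' : ∀ ω, |r ω| ≤ 1 := fun ω => by rw [abs_of_nonneg (hr0 ω)]; exact hr1 ω
  set g : Ω → ℝ := fun ω => f ω * k ω * (Real.exp (θ ω * r ω) - 1) with hg
  have hem : Measurable[beforeChoice R R' I t] fun ω => Real.exp (θ ω * r ω) - 1 :=
    (Real.measurable_exp.comp ((hθ.mono hp le_rfl).mul hrm)).sub_const 1
  have hgm : Measurable[beforeChoice R R' I t] g := ((hf.mul hkm).mono hp le_rfl).mul hem
  have hgB : ∀ ω, |g ω| ≤ B * Real.exp 2 * 2 := bound he2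
  have hfki : Integrable (fun ω => f ω * k ω) P :=
    Integrable.of_bound ((hf.mul hkm).mono hpm le_rfl).aestronglyMeasurable _ (ae_of_all _ hfk)
  have hgY : Integrable (fun ω => g ω * pulled I i t ω) P := integ (hem.mono hm le_rfl) he2
    (measurable_pulled (i := i) (h.measurable_arm t ht)) (abs_pulled_le i t)
  have hgq : Integrable (fun ω => g ω * q ω) P :=
    integ (hem.mono hm le_rfl) he2 (hqm.mono hpm le_rfl) hq1'
  have hfi : Integrable f P := Integrable.of_bound (hf.mono hpm le_rfl).aestronglyMeasurable B
    (ae_of_all _ fun ω => by rw [Real.norm_eq_abs, abs_of_nonneg (hf0 ω)]; exact hfB ω)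
  -- the part of the conditional expectation that is linear in the reward
  set b : Ω → ℝ := fun ω => f ω * k ω * (q ω * 1 * (Real.exp (θ ω) - 1)) with hb
  have hb2 : ∀ ω, |q ω * 1 * (Real.exp (θ ω) - 1)| ≤ 2 := fun ω =>
    abs_prod₃_le (hq0 ω) (hq1 ω) zero_le_one le_rfl (abs_exp_sub_one_le_two (hθ1 ω))
  have hcm : Measurable[past R R' I t] fun ω => q ω * 1 * (Real.exp (θ ω) - 1) :=
    (hqm.mul_const 1).mul ((Real.measurable_exp.comp hθ).sub_const 1)
  have hbm : Measurable[past R R' I t] b := (hf.mul hkm).mul hcm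
  have hbr : Integrable (fun ω => b ω * r ω) P :=
    integ (hcm.mono hpm le_rfl) hb2 (hrm.mono hm le_rfl) hr1'
  have hbμ : Integrable (fun ω => b ω * μ) P :=
    integ (hcm.mono hpm le_rfl) hb2 measurable_const fun _ => by
      rw [abs_of_nonneg hμ0]; exact hμ1
  have hind : IndepFun b r P := by
    rw [IndepFun_iff_Indep]
    exact indep_of_indep_of_le_left (indep_of_indep_of_le_right (h.indep_reward t ht).symm
      hrR.comap_le) hbm.comap_le
  have hmean : ∫ ω, b ω * r ω ∂P = ∫ ω, b ω * μ ∂P := by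
    rw [hind.integral_fun_mul_eq_mul_integral (hbm.mono hpm le_rfl).aestronglyMeasurable
      (hrm.mono hm le_rfl).aestronglyMeasurable, h.integral_clip_reward hν ht, integral_mul_const]
  calc _ = ∫ ω, (f ω * k ω + g ω * pulled I i t ω) ∂P := by
        refine integral_congr_ae (ae_of_all _ fun ω => ?_)
        have : Real.exp (θ ω * (pulled I i t ω * r ω)) =
            1 + (Real.exp (θ ω * r ω) - 1) * pulled I i t ω := by
          unfold pulled; split_ifs <;> simp
        change f ω * Real.exp (θ ω * (pulled I i t ω * r ω) - _) = _
        simp only [hg, hk, sub_eq_add_neg (θ ω * _), Real.exp_add, this]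
        ring
    _ = ∫ ω, (f ω * k ω + g ω * q ω) ∂P := by
        rw [integral_add hfki hgY, integral_add hfki hgq,
          h.integral_mul_pulled ht i hgm hgB fun ω hω => hq ω fun h0 => hω (by simp [hg, h0])]
    _ ≤ ∫ ω, (f ω * k ω + b ω * r ω) ∂P := by
        refine integral_mono (hfki.add hgq) (hfki.add hbr) fun ω => ?_
        have := mul_le_mul_of_nonneg_left (exp_mul_sub_one_le (θ := θ ω) (hr0 ω) (hr1 ω))
          (mul_nonneg (hfk0 ω) (hq0 ω))
        simp only [hg, hb]
        linarith
    _ = ∫ ω, (f ω * k ω + b ω * μ) ∂P := by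
        rw [integral_add hfki hbr, integral_add hfki hbμ, hmean]
    _ ≤ ∫ ω, f ω ∂P := by
        refine integral_mono (hfki.add hbμ) hfi fun ω => ?_
        have h2 := mul_le_mul_of_nonneg_left
          (exp_neg_mul_one_add_le (q := q ω) (v := μ) (e := Real.exp (θ ω) - 1)) (hf0 ω)
        simp only [hb, hk]
        linarith

/-- Markov's inequality for a product of factors, each of which has conditional expectation at
most `1` given the past. -/
lemma IsBarbarRun.measureReal_lt_sum_le [IsProbabilityMeasure P] (h : IsBarbarRun P ν δ T R R' I)
    {z : ℕ → Ω → ℝ} (hz : ∀ t ∈ Finset.Icc 1 T, Measurable[past R R' I (t + 1)] (z t))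
    {b : ℝ} (hzb : ∀ t ∈ Finset.Icc 1 T, ∀ ω, z t ω ≤ b)
    (hstep : ∀ t ∈ Finset.Icc 1 T, ∀ (f : Ω → ℝ) (B : ℝ), Measurable[past R R' I t] f →
      (∀ ω, 0 ≤ f ω) → (∀ ω, f ω ≤ B) → ∫ ω, f ω * Real.exp (z t ω) ∂P ≤ ∫ ω, f ω ∂P) (L : ℝ) :
    P.real {ω | L < ∑ t ∈ Finset.Icc 1 T, z t ω} ≤ Real.exp (-L) := by
  have key : ∀ n ≤ T,
      Measurable[past R R' I (n + 1)] (fun ω => Real.exp (∑ t ∈ Finset.Icc 1 n, z t ω)) ∧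
      (∃ B, ∀ ω, Real.exp (∑ t ∈ Finset.Icc 1 n, z t ω) ≤ B) ∧
      ∫ ω, Real.exp (∑ t ∈ Finset.Icc 1 n, z t ω) ∂P ≤ 1 := by
    intro n
    induction n with
    | zero => intro _; refine ⟨by simp, ⟨1, by simp⟩, by simp⟩
    | succ n ih =>
      intro hn
      obtain ⟨hm, ⟨B, hB⟩, hle⟩ := ih (by omega)
      have hmem : n + 1 ∈ Finset.Icc 1 T := Finset.mem_Icc.2 ⟨by omega, hn⟩
      have hsucc : ∀ ω, Real.exp (∑ t ∈ Finset.Icc 1 (n + 1), z t ω) =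
          Real.exp (∑ t ∈ Finset.Icc 1 n, z t ω) * Real.exp (z (n + 1) ω) := fun ω => by
        rw [Finset.sum_Icc_succ_top (by omega), Real.exp_add]
      simp only [hsucc]
      refine ⟨?_, ⟨B * Real.exp b, fun ω => ?_⟩, ?_⟩
      · exact (hm.mono (past_mono (by omega)) le_rfl).mul (Real.measurable_exp.comp (hz _ hmem))
      · exact mul_le_mul (hB ω) (Real.exp_le_exp.2 (hzb _ hmem ω)) (Real.exp_pos _).le
          ((Real.exp_pos _).le.trans (hB ω))
      · exact (hstep _ hmem _ B hm (fun ω => (Real.exp_pos _).le) hB).trans hle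
  obtain ⟨hm, ⟨B, hB⟩, hle⟩ := key T le_rfl
  have hint : Integrable (fun ω => Real.exp (∑ t ∈ Finset.Icc 1 T, z t ω)) P :=
    Integrable.of_bound (hm.mono (h.past_le le_rfl) le_rfl).aestronglyMeasurable B
      (ae_of_all _ fun ω => by rw [Real.norm_eq_abs, abs_of_pos (Real.exp_pos _)]; exact hB ω)
  have hmk := mul_meas_ge_le_integral_of_nonneg (ae_of_all _ fun ω => (Real.exp_pos _).le) hint
    (Real.exp L)
  have hsub : P.real {ω | L < ∑ t ∈ Finset.Icc 1 T, z t ω} ≤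
      P.real {ω | Real.exp L ≤ Real.exp (∑ t ∈ Finset.Icc 1 T, z t ω)} :=
    measureReal_mono fun ω hω => Real.exp_le_exp.2 (le_of_lt hω)
  rw [Real.exp_neg, ← one_div, le_div_iff₀ (Real.exp_pos _), mul_comm]
  exact (mul_le_mul_of_nonneg_left hsub (Real.exp_pos _).le).trans (hmk.trans hle)

end Supermartingale

/-! ### The concentration event -/

section Concentration

variable {K : ℕ}

/-- The rounds up to the horizon `T` that belong to epoch `j`, counted from `0`. -/
noncomputable def rounds (l : ℝ) (a : ℕ → Fin K) (x : ℕ → ℝ) (T j : ℕ) : Finset ℕ :=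
  (Finset.Icc 1 T).filter (InEpoch l a x j)

/-- The exponent of the supermartingale for arm `i` in epoch `j`. The total of `u` over the pulls
of arm `i` is compared with the total of `v` over all rounds, scaled by the probability of a pull.
The parameter `θ` of the exponential may depend on the current gap estimate, through `g`. -/
noncomputable def excess (l : ℝ) (T : ℕ) (a : ℕ → Fin K) (x : ℕ → ℝ) (j : ℕ) (i : Fin K) (g : ℝ → ℝ)
    (u v : ℕ → ℝ) : ℝ :=
  g ((state l a x j).gap i) * (∑ t ∈ rounds l a x T j, if a t = i then u t else 0) -
    (state l a x j).pulls l i / (state l a x j).length l *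
      (Real.exp (g ((state l a x j).gap i)) - 1) * ∑ t ∈ rounds l a x T j, v t

/-- The parameter of the exponential for the rewards, proportional to the gap estimate and
truncated so that it is bounded on every sample path. -/
noncomputable def rate (d : ℝ) : ℝ := max 0 (min d 1) / 32

lemma measurable_rate : Measurable rate :=
  (measurable_const.max (measurable_id.min measurable_const)).div_const 32

lemma abs_rate_le_one (d : ℝ) : |rate d| ≤ 1 := by
  have h : max 0 (min d 1) ≤ 1 := max_le zero_le_one (min_le_right d 1)
  rw [rate, abs_of_nonneg (by positivity)]
  linarith

lemma rate_of_mem {d : ℝ} (h0 : 0 ≤ d) (h1 : d ≤ 1) : rate d = d / 32 := by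
  rw [rate, min_eq_left h1, max_eq_right h0]

/-- The concentration event for arm `i` in epoch `j`: the rewards of the arm are close to the mean
`μ` from above and below, the arm is not pulled too often, and the corruption `c` is spread over
the arms in proportion to the pulls. -/
structure Concentrated (l L : ℝ) (T : ℕ) (a : ℕ → Fin K) (x : ℕ → ℝ) (r : ℕ → Fin K → ℝ)
    (c : ℕ → ℝ) (μ : Fin K → ℝ) (j : ℕ) (i : Fin K) : Prop where
  upper : excess l T a x j i rate (fun t => r t i) (fun _ => μ i) ≤ L
  lower : excess l T a x j i (fun d => -rate d) (fun t => r t i) (fun _ => μ i) ≤ L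
  count : excess l T a x j i rate (fun _ => 1) (fun _ => 1) ≤ L
  corrupted : excess l T a x j i (fun _ => 1) c c ≤ L

/-- The corruption of a round, truncated at `1`; almost surely nothing is truncated. -/
noncomputable def corr {Ω : Type*} (R R' : ℕ → Ω → Fin K → ℝ) (t : ℕ) (ω : Ω) : ℝ :=
  min 1 ‖R' t ω - R t ω‖

lemma measurable_corr {Ω : Type*} {R R' : ℕ → Ω → Fin K → ℝ} {m : MeasurableSpace Ω} {t : ℕ}
    (hR : Measurable (R t)) (hR' : Measurable (R' t)) : Measurable (corr R R' t) :=
  measurable_const.min (hR'.sub hR).norm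

variable {Ω : Type*} [MeasurableSpace Ω] {P : Measure Ω} {ν : Fin K → Measure ℝ} {δ : ℝ}
  {T : ℕ} {R R' : ℕ → Ω → Fin K → ℝ} {I : ℕ → Ω → Fin K}

/-- Restricted to the rounds of an epoch, the one-step exponents add up to `excess`. -/
lemma sum_exponent_eq_excess {l : ℝ} {a : ℕ → Fin K} {x : ℕ → ℝ} {j : ℕ} {i : Fin K} {g : ℝ → ℝ}
    {u v y : ℕ → ℝ} (hy : ∀ t, y t = if a t = i then 1 else 0) :
    ∑ t ∈ Finset.Icc 1 T,
      ((if InEpoch l a x j t then g ((state l a x j).gap i) else 0) * (y t * u t) -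
        (if InEpoch l a x j t then (state l a x j).pulls l i / (state l a x j).length l else 0) *
          v t *
          (Real.exp (if InEpoch l a x j t then g ((state l a x j).gap i) else 0) - 1)) =
      excess l T a x j i g u v := by
  rw [excess, Finset.mul_sum, Finset.mul_sum, ← Finset.sum_sub_distrib, rounds, Finset.sum_filter]
  refine Finset.sum_congr rfl fun t _ => ?_
  by_cases h : InEpoch l a x j t
  · simp only [h, if_true, hy]
    split_ifs <;> ring
  · simp [h]

variable [IsProbabilityMeasure P]

/-- One-step bounds that hold for every predictable parameter `θ` and pull probability `q` give a
tail bound for `excess`. -/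
lemma IsBarbarRun.measureReal_lt_excess_le (h : IsBarbarRun P ν δ T R R' I)
    (hl : 0 < lam K δ T) (j : ℕ) (i : Fin K) {g : ℝ → ℝ} (hg : Measurable g)
    (hg1 : ∀ d, |g d| ≤ 1) {u v : ℕ → Ω → ℝ}
    (hu : ∀ t ∈ Finset.Icc 1 T, Measurable[past R R' I (t + 1)] (u t))
    (hv : ∀ t ∈ Finset.Icc 1 T, Measurable[past R R' I (t + 1)] (v t))
    (hu0 : ∀ t ω, 0 ≤ u t ω) (hu1 : ∀ t ω, u t ω ≤ 1)
    (hv0 : ∀ t ω, 0 ≤ v t ω) (hv1 : ∀ t ω, v t ω ≤ 1)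
    (hstep : ∀ t ∈ Finset.Icc 1 T, ∀ (f θ q : Ω → ℝ) (B : ℝ), Measurable[past R R' I t] f →
      (∀ ω, 0 ≤ f ω) → (∀ ω, f ω ≤ B) → Measurable[past R R' I t] θ → (∀ ω, |θ ω| ≤ 1) →
      Measurable[past R R' I t] q → (∀ ω, 0 ≤ q ω) → (∀ ω, q ω ≤ 1) →
      (∀ ω, θ ω ≠ 0 → barbarProb δ T (fun s => I s ω) (fun s => R' s ω (I s ω)) t i = q ω) →
      ∫ ω, f ω * Real.exp (θ ω * (pulled I i t ω * u t ω) - q ω * v t ω * (Real.exp (θ ω) - 1)) ∂P ≤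
        ∫ ω, f ω ∂P) (L : ℝ) :
    P.real {ω | L < excess (lam K δ T) T (fun s => I s ω) (fun s => R' s ω (I s ω)) j i g
      (fun t => u t ω) (fun t => v t ω)} ≤ Real.exp (-L) := by
  have : Nonempty (Fin K) := ⟨i⟩
  set l := lam K δ T with hldef
  set θ : ℕ → Ω → ℝ := fun t ω => if InEpoch l (fun s => I s ω) (fun s => R' s ω (I s ω)) j t then
    g ((state l (fun s => I s ω) (fun s => R' s ω (I s ω)) j).gap i) else 0 with hθdef
  set q : ℕ → Ω → ℝ := fun t ω => if InEpoch l (fun s => I s ω) (fun s => R' s ω (I s ω)) j t then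
    (state l (fun s => I s ω) (fun s => R' s ω (I s ω)) j).pulls l i /
      (state l (fun s => I s ω) (fun s => R' s ω (I s ω)) j).length l else 0 with hqdef
  have hθm : ∀ t, Measurable[past R R' I t] (θ t) := fun t =>
    measurable_past_inEpoch hl j t (G := fun s => g (s.gap i)) (hg.comp ((measurable_state l j).1 i))
  have hqm : ∀ t, Measurable[past R R' I t] (q t) := fun t =>
    measurable_past_inEpoch hl j t (G := fun s => s.pulls l i / s.length l)
      ((measurable_state_pulls l j i).div (measurable_state_length l j))
  have hθ1 : ∀ t ω, |θ t ω| ≤ 1 := fun t ω => by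
    simp only [hθdef]; split_ifs
    · exact hg1 _
    · simp
  have hq0 : ∀ t ω, 0 ≤ q t ω := fun t ω => by
    simp only [hqdef]; split_ifs
    · exact div_nonneg (state_pulls_pos hl j i).le (state_length_pos hl j).le
    · exact le_rfl
  have hq1 : ∀ t ω, q t ω ≤ 1 := fun t ω => by
    simp only [hqdef]; split_ifs
    · exact div_le_one_of_le₀ (state_pulls_le_length hl j i) (state_length_pos hl j).le
    · exact zero_le_one
  have hq : ∀ t ω, θ t ω ≠ 0 →
      barbarProb δ T (fun s => I s ω) (fun s => R' s ω (I s ω)) t i = q t ω := fun t ω h0 => by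
    by_cases hin : InEpoch l (fun s => I s ω) (fun s => R' s ω (I s ω)) j t
    · simp only [hqdef, hin, if_true]; exact hin.barbarProb_eq hl i
    · simp [hθdef, hin] at h0
  have key := h.measureReal_lt_sum_le (b := 3)
    (z := fun t ω => θ t ω * (pulled I i t ω * u t ω) - q t ω * v t ω * (Real.exp (θ t ω) - 1))
    ?_ ?_ ?_ L
  · refine le_trans (le_of_eq ?_) key
    congr 1
    ext ω
    simp only [Set.mem_ofPred_eq]
    rw [← sum_exponent_eq_excess (y := fun t => pulled I i t ω) fun t => rfl]
  · intro t ht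
    have hp : past R R' I t ≤ past R R' I (t + 1) := past_mono (Nat.le_succ t)
    have hθt := (hθm t).mono hp le_rfl
    exact (hθt.mul ((measurable_pulled (measurable_past_arm
      (Finset.mem_Ico.2 ⟨(Finset.mem_Icc.1 ht).1, Nat.lt_succ_self t⟩))).mul (hu t ht))).sub
      ((((hqm t).mono hp le_rfl).mul (hv t ht)).mul
        ((Real.measurable_exp.comp hθt).sub_const 1))
  · intro t _ ω
    have h1 : |θ t ω * (pulled I i t ω * u t ω)| ≤ 1 := by
      rw [abs_mul, abs_mul, abs_of_nonneg (hu0 t ω)]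
      exact mul_le_one₀ (hθ1 t ω) (mul_nonneg (abs_nonneg _) (hu0 t ω))
        (mul_le_one₀ (abs_pulled_le i t ω) (hu0 t ω) (hu1 t ω))
    have h2 := abs_prod₃_le (hq0 t ω) (hq1 t ω) (hv0 t ω) (hv1 t ω)
      (abs_exp_sub_one_le_two (hθ1 t ω))
    linarith [(abs_le.1 h1).2, (abs_le.1 h2).1]
  · intro t ht f B hf hf0 hfB
    exact hstep t ht f (θ t) (q t) B hf hf0 hfB (hθm t) (hθ1 t) (hqm t) (hq0 t) (hq1 t) (hq t)

/-- Tail bound for quantities `c` that are fixed before the player chooses. -/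
lemma IsBarbarRun.measureReal_lt_excess_choice_le (h : IsBarbarRun P ν δ T R R' I)
    (hl : 0 < lam K δ T) (j : ℕ) (i : Fin K) {g : ℝ → ℝ} (hg : Measurable g)
    (hg1 : ∀ d, |g d| ≤ 1) {c : ℕ → Ω → ℝ}
    (hc : ∀ t ∈ Finset.Icc 1 T, Measurable[beforeChoice R R' I t] (c t)) (hc0 : ∀ t ω, 0 ≤ c t ω)
    (hc1 : ∀ t ω, c t ω ≤ 1) (L : ℝ) :
    P.real {ω | L < excess (lam K δ T) T (fun s => I s ω) (fun s => R' s ω (I s ω)) j i g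
      (fun t => c t ω) (fun t => c t ω)} ≤ Real.exp (-L) := by
  have hcm : ∀ t ∈ Finset.Icc 1 T, Measurable[past R R' I (t + 1)] (c t) := fun t ht =>
    (hc t ht).mono (beforeChoice_le_past_succ (Finset.mem_Icc.1 ht).1) le_rfl
  exact h.measureReal_lt_excess_le hl j i hg hg1 hcm hcm hc0 hc1 hc0 hc1
    (fun t ht f θ q B hf hf0 hfB hθ hθ1 hqm hq0 hq1 hq =>
      h.integral_mul_exp_choice_le ht i hf hf0 hfB hθ hθ1 hqm hq0 hq1 hq (hc t ht) (hc0 t) (hc1 t)) L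

/-- Tail bound for the rewards of an arm. -/
lemma IsBarbarRun.measureReal_lt_excess_reward_le (h : IsBarbarRun P ν δ T R R' I)
    (hl : 0 < lam K δ T) (j : ℕ) (i : Fin K) [IsProbabilityMeasure (ν i)]
    (hν : ∀ᵐ y ∂(ν i), y ∈ Set.Icc (0 : ℝ) 1) {g : ℝ → ℝ} (hg : Measurable g)
    (hg1 : ∀ d, |g d| ≤ 1) (L : ℝ) :
    P.real {ω | L < excess (lam K δ T) T (fun s => I s ω) (fun s => R' s ω (I s ω)) j i g
      (fun t => clip (R t ω i)) (fun _ => mean ν i)} ≤ Real.exp (-L) := by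
  obtain ⟨hμ0, hμ1⟩ := mean_mem_Icc hν
  exact h.measureReal_lt_excess_le hl j i hg hg1 (u := fun t ω => clip (R t ω i))
    (v := fun _ _ => mean ν i)
    (fun t ht => measurable_clip.comp ((measurable_pi_apply i).comp
      ((measurable_beforeChoice_reward t).mono
        (beforeChoice_le_past_succ (Finset.mem_Icc.1 ht).1) le_rfl)))
    (fun t _ => measurable_const) (fun _ _ => clip_nonneg _) (fun _ _ => clip_le_one _)
    (fun _ _ => hμ0) (fun _ _ => hμ1)
    (fun t ht f θ q B hf hf0 hfB hθ hθ1 hqm hq0 hq1 hq =>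
      h.integral_mul_exp_reward_le ht i hν hf hf0 hfB hθ hθ1 hqm hq0 hq1 hq) L

/-- A union bound over the arms and the first `M` epochs. -/
lemma IsBarbarRun.measureReal_not_concentrated_le (h : IsBarbarRun P ν δ T R R' I)
    (hl : 0 < lam K δ T) (hν' : ∀ i, IsProbabilityMeasure (ν i))
    (hν : ∀ i, ∀ᵐ y ∂(ν i), y ∈ Set.Icc (0 : ℝ) 1) (L : ℝ) (M : ℕ) :
    P.real {ω | ¬ ∀ j < M, ∀ i, Concentrated (lam K δ T) L T (fun s => I s ω)
      (fun s => R' s ω (I s ω)) (fun t k => clip (R t ω k)) (fun t => corr R R' t ω) (mean ν) j i} ≤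
      M * K * (4 * Real.exp (-L)) := by
  have hone : ∀ j i, P.real {ω | ¬ Concentrated (lam K δ T) L T (fun s => I s ω)
      (fun s => R' s ω (I s ω)) (fun t k => clip (R t ω k)) (fun t => corr R R' t ω) (mean ν) j i} ≤
      4 * Real.exp (-L) := by
    intro j i
    have := hν' i
    have e1 := h.measureReal_lt_excess_reward_le hl j i (hν i) measurable_rate abs_rate_le_one L
    have e2 := h.measureReal_lt_excess_reward_le hl j i (hν i) measurable_rate.neg
      (fun d => by simpa using abs_rate_le_one d) L
    have e3 := h.measureReal_lt_excess_choice_le hl j i measurable_rate abs_rate_le_one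
      (c := fun _ _ => 1) (fun _ _ => measurable_const) (fun _ _ => zero_le_one)
      (fun _ _ => le_rfl) L
    have e4 := h.measureReal_lt_excess_choice_le hl j i (measurable_const (a := (1 : ℝ)))
      (fun _ => by simp) (c := corr R R')
      (fun t _ => measurable_corr (measurable_beforeChoice_reward t)
        (measurable_beforeChoice_corrupted t))
      (fun _ _ => le_min zero_le_one (norm_nonneg _)) (fun _ _ => min_le_left _ _) L
    have e := (measureReal_union_le _ _).trans (add_le_add e1 ((measureReal_union_le _ _).trans
      (add_le_add e2 ((measureReal_union_le _ _).trans (add_le_add e3 e4)))))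
    refine (measureReal_mono (fun ω hω => ?_) (measure_ne_top P _)).trans (e.trans (by linarith))
    by_contra hc
    simp only [Set.mem_union, Set.mem_ofPred_eq, not_or, not_lt] at hc
    exact hω ⟨hc.1, hc.2.1, hc.2.2.1, hc.2.2.2⟩
  calc _ ≤ P.real (⋃ p ∈ Finset.range M ×ˢ (Finset.univ : Finset (Fin K)),
        {ω | ¬ Concentrated (lam K δ T) L T (fun s => I s ω) (fun s => R' s ω (I s ω))
          (fun t k => clip (R t ω k)) (fun t => corr R R' t ω) (mean ν) p.1 p.2}) := by
        refine measureReal_mono (fun ω hω => ?_) (measure_ne_top P _)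
        simp only [Set.mem_ofPred_eq, not_forall] at hω
        obtain ⟨j, hj, i, hc⟩ := hω
        exact Set.mem_biUnion (x := (j, i)) (by simp [hj]) hc
    _ ≤ ∑ p ∈ Finset.range M ×ˢ (Finset.univ : Finset (Fin K)), 4 * Real.exp (-L) :=
        (measureReal_biUnion_finset_le _ _).trans (Finset.sum_le_sum fun p _ => hone p.1 p.2)
    _ = M * K * (4 * Real.exp (-L)) := by simp

end Concentration

/-! ### Regret on the concentration event -/

section Numeric

lemma exp_sub_one_le_of_abs_le {θ : ℝ} (h : |θ| ≤ 1 / 32) :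
    Real.exp θ - 1 ≤ θ + 0.6 * θ ^ 2 := by
  have hb := Real.exp_bound (x := θ) (by linarith) (n := 3) (by norm_num)
  simp only [Finset.sum_range_succ, Finset.sum_range_zero, Nat.factorial] at hb
  norm_num at hb
  have h3 : |θ| ^ 3 ≤ 1 / 32 * θ ^ 2 := by
    rw [pow_succ' |θ| 2, sq_abs]
    exact mul_le_mul_of_nonneg_right h (sq_nonneg θ)
  have := (abs_le.1 hb).2
  linarith [sq_nonneg θ]

variable {A n N m q μ d L : ℝ}

/-- The Chernoff bound solved for the total reward `A`, with gap estimate `d`, `n` planned pulls, an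
epoch of `m ≈ N` rounds and `θ = d / 32`. The relation `n d² = 1024 L` between `n` and the
confidence level turns the deviation into a fraction of `n d`. -/
lemma le_mul_add_of_exp_bound (hd0 : 0 < d) (hd1 : d ≤ 1) (hL : 2 ≤ L) (hn : n * d ^ 2 = 1024 * L)
    (hqN : q * N = n) (hq0 : 0 ≤ q) (hq1 : q ≤ 1) (hm : m ≤ N + 1) (hm0 : 0 ≤ m) (hμ0 : 0 ≤ μ)
    (hμ1 : μ ≤ 1) (h : d / 32 * A - q * (Real.exp (d / 32) - 1) * (m * μ) ≤ L) :
    A ≤ n * μ + 0.055 * (n * d) := by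
  have he := exp_sub_one_le_of_abs_le (θ := d / 32) (by
    rw [abs_of_nonneg (by positivity)]; linarith)
  have hnd : 2048 ≤ n * d := by nlinarith
  have hn0 : 0 < n := by nlinarith
  have hqm0 : 0 ≤ q * m := mul_nonneg hq0 hm0
  have hqm : q * m ≤ n + 1 := by nlinarith
  have h1 : q * (Real.exp (d / 32) - 1) * (m * μ) ≤
      d / 32 * ((q * m) * μ * (1 + 0.6 * (d / 32))) := by
    have := mul_le_mul_of_nonneg_left he (mul_nonneg hqm0 hμ0)
    linarith
  have h2 : L = d / 32 * (n * d / 32) := by linarith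
  have h3 : d / 32 * A ≤ d / 32 * (n * d / 32 + (q * m) * μ * (1 + 0.6 * (d / 32))) := by
    linarith
  have h4 := le_of_mul_le_mul_left h3 (by positivity)
  have h5 : (q * m) * μ * (1 + 0.6 * (d / 32)) ≤ (n + 1) * μ * (1 + 0.6 * (d / 32)) := by
    gcongr
  have h6 : (n + 1) * μ * (0.6 * (d / 32)) ≤ (n + 1) * 1 * (0.6 * (d / 32)) := by
    gcongr
  linarith

/-- The lower counterpart of `le_mul_add_of_exp_bound`. -/
lemma mul_sub_le_of_exp_bound (hd0 : 0 < d) (hd1 : d ≤ 1) (hL : 2 ≤ L) (hn : n * d ^ 2 = 1024 * L)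
    (hqN : q * N = n) (hq0 : 0 ≤ q) (hq1 : q ≤ 1) (hm : m ≤ N + 1) (hm' : N - 1 ≤ m) (hm0 : 0 ≤ m)
    (hμ0 : 0 ≤ μ) (hμ1 : μ ≤ 1)
    (h : -(d / 32) * A - q * (Real.exp (-(d / 32)) - 1) * (m * μ) ≤ L) :
    n * μ - 0.055 * (n * d) ≤ A := by
  have he := exp_sub_one_le_of_abs_le (θ := -(d / 32)) (by
    rw [abs_neg, abs_of_nonneg (by positivity)]; linarith)
  have hnd : 2048 ≤ n * d := by nlinarith
  have hn0 : 0 < n := by nlinarith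
  have hqm0 : 0 ≤ q * m := mul_nonneg hq0 hm0
  have hqm : q * m ≤ n + 1 := by nlinarith
  have hqm' : n - 1 ≤ q * m := by nlinarith
  have h1 : q * (Real.exp (-(d / 32)) - 1) * (m * μ) ≤
      d / 32 * ((q * m) * μ * (-1 + 0.6 * (d / 32))) := by
    have := mul_le_mul_of_nonneg_left he (mul_nonneg hqm0 hμ0)
    linarith
  have h2 : L = d / 32 * (n * d / 32) := by linarith
  have h3 : d / 32 * (-(n * d / 32) + (q * m) * μ * (1 - 0.6 * (d / 32))) ≤ d / 32 * A := by
    linarith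
  have h4 := le_of_mul_le_mul_left h3 (by positivity)
  have h5 : (n - 1) * μ ≤ (q * m) * μ := by gcongr
  have h6 : (q * m) * μ * (0.6 * (d / 32)) ≤ (n + 1) * 1 * (0.6 * (d / 32)) := by
    gcongr
  linarith

end Numeric

section Path

variable {K : ℕ} {T : ℕ} {a : ℕ → Fin K} {x : ℕ → ℝ}

lemma mem_Ioc_floor_state_time [Nonempty (Fin K)] {l : ℝ} (hl : 0 < l) (j t : ℕ) :
    t ∈ Finset.Ioc ⌊(state l a x j).time⌋₊ ⌊(state l a x (j + 1)).time⌋₊ ↔ InEpoch l a x j t := by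
  rw [Finset.mem_Ioc, Nat.floor_lt (state_time_nonneg hl j),
    Nat.le_floor_iff (state_time_nonneg hl (j + 1)), InEpoch]

lemma rounds_eq_Ioc [Nonempty (Fin K)] {l : ℝ} (hl : 0 < l) {j : ℕ}
    (hj : (state l a x (j + 1)).time ≤ T) :
    rounds l a x T j =
      Finset.Ioc ⌊(state l a x j).time⌋₊ ⌊(state l a x j).time + (state l a x j).length l⌋₊ := by
  ext t
  rw [← state_time_succ, mem_Ioc_floor_state_time hl, rounds, Finset.mem_filter,
    and_iff_right_iff_imp, Finset.mem_Icc]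
  intro h
  refine ⟨?_, by exact_mod_cast h.2.trans hj⟩
  have : (0 : ℝ) < t := (state_time_nonneg hl j).trans_lt h.1
  exact_mod_cast this

lemma card_rounds_le [Nonempty (Fin K)] {l : ℝ} (hl : 0 < l) (j : ℕ) :
    ((rounds l a x T j).card : ℝ) ≤ (state l a x j).length l + 1 := by
  have hsub : rounds l a x T j ⊆
      Finset.Ioc ⌊(state l a x j).time⌋₊ ⌊(state l a x (j + 1)).time⌋₊ := fun t ht =>
    (mem_Ioc_floor_state_time hl j t).2 (Finset.mem_filter.1 ht).2
  have h1 := Finset.card_le_card hsub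
  rw [Nat.card_Ioc] at h1
  have h0 : ⌊(state l a x j).time⌋₊ ≤ ⌊(state l a x (j + 1)).time⌋₊ :=
    Nat.floor_mono ((strictMono_state_time hl).monotone (Nat.le_succ j))
  have h2 : ((rounds l a x T j).card : ℝ) ≤
      (⌊(state l a x (j + 1)).time⌋₊ : ℝ) - ⌊(state l a x j).time⌋₊ := by
    rw [← Nat.cast_sub h0]; exact_mod_cast h1
  have h3 := Nat.floor_le (state_time_nonneg (a := a) (x := x) hl (j + 1))
  have h4 := Nat.lt_floor_add_one (state l a x j).time
  rw [state_time_succ] at h3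
  rw [state_time_succ] at h2
  linarith

lemma le_card_rounds [Nonempty (Fin K)] {l : ℝ} (hl : 0 < l) {j : ℕ}
    (hj : (state l a x (j + 1)).time ≤ T) :
    (state l a x j).length l - 1 ≤ (rounds l a x T j).card := by
  rw [rounds_eq_Ioc hl hj, ← state_time_succ, Nat.card_Ioc,
    Nat.cast_sub (Nat.floor_mono ((strictMono_state_time hl).monotone (Nat.le_succ j)))]
  have h3 := Nat.floor_le (state_time_nonneg (a := a) (x := x) hl j)
  have h4 := Nat.lt_floor_add_one (state l a x (j + 1)).time
  rw [state_time_succ] at *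
  linarith

lemma avg_eq_sum_rounds [Nonempty (Fin K)] {l : ℝ} (hl : 0 < l) {j : ℕ}
    (hj : (state l a x (j + 1)).time ≤ T) (i : Fin K) :
    (state l a x j).avg l a x i =
      (∑ t ∈ rounds l a x T j, if a t = i then x t else 0) / (state l a x j).pulls l i := by
  rw [rounds_eq_Ioc hl hj]; rfl

/-- The epochs that start before the horizon partition the rounds. -/
lemma sum_rounds [Nonempty (Fin K)] {l : ℝ} (hl : 4 ≤ l) (hT : 2 ≤ T) (f : ℕ → ℝ) :
    ∑ t ∈ Finset.Icc 1 T, f t = ∑ j ∈ Finset.range (Nat.log 2 T), ∑ t ∈ rounds l a x T j, f t := by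
  rw [← Finset.sum_biUnion]
  · congr 1
    ext t
    simp only [Finset.mem_biUnion, Finset.mem_range, rounds, Finset.mem_filter]
    constructor
    · intro ht
      obtain ⟨j, hj, hin⟩ := exists_inEpoch (a := a) (x := x) hl hT ht
      exact ⟨j, hj, ht, hin⟩
    · rintro ⟨_, _, ht, _⟩
      exact ht
  · intro j _ k _ hjk
    refine Finset.disjoint_left.2 fun t h1 h2 => hjk ?_
    exact (Finset.mem_filter.1 h1).2.eq (by linarith) (Finset.mem_filter.1 h2).2

/-- A sample path on which all estimates of BARBAR concentrate: `a` are the pulled arms, `x` the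
feedback, `r` the uncorrupted rewards, `c` bounds the corruption of each round, `μ` are the
means. -/
structure GoodPath (L : ℝ) (T : ℕ) (a : ℕ → Fin K) (x : ℕ → ℝ) (r : ℕ → Fin K → ℝ)
    (c : ℕ → ℝ) (μ : Fin K → ℝ) : Prop where
  two_le : 2 ≤ L
  horizon : 2 ≤ T
  feedback_mem : ∀ t ∈ Finset.Icc 1 T, x t ∈ Set.Icc (0 : ℝ) 1
  abs_sub_le : ∀ t ∈ Finset.Icc 1 T, |x t - r t (a t)| ≤ c t
  mean_mem : ∀ i, μ i ∈ Set.Icc (0 : ℝ) 1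
  concentrated : ∀ j < Nat.log 2 T, ∀ i, Concentrated (1024 * L) L T a x r c μ j i

/-- The sum of the corruption rates `2 C / N` of the epochs `0, …, j - 1`, discounted by a factor
`1 / 8` for each later epoch. -/
noncomputable def discountedCorr (l : ℝ) (T : ℕ) (a : ℕ → Fin K) (x : ℕ → ℝ) (c : ℕ → ℝ) : ℕ → ℝ
  | 0 => 0
  | j + 1 => 2 * (∑ t ∈ rounds l a x T j, c t) / (state l a x j).length l +
      discountedCorr l T a x c j / 8

namespace GoodPath

variable {L : ℝ} {r : ℕ → Fin K → ℝ} {c : ℕ → ℝ} {μ : Fin K → ℝ}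

lemma lam_pos (h : GoodPath L T a x r c μ) : 0 < 1024 * L := by linarith [h.two_le]

lemma four_le_lam (h : GoodPath L T a x r c μ) : 4 ≤ 1024 * L := by linarith [h.two_le]

lemma corr_nonneg (h : GoodPath L T a x r c μ) {t : ℕ} (ht : t ∈ Finset.Icc 1 T) : 0 ≤ c t :=
  (abs_nonneg _).trans (h.abs_sub_le t ht)

lemma sum_corr_nonneg (h : GoodPath L T a x r c μ) (j : ℕ) :
    0 ≤ ∑ t ∈ rounds (1024 * L) a x T j, c t :=
  Finset.sum_nonneg fun _ ht => h.corr_nonneg (Finset.mem_filter.1 ht).1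

lemma discountedCorr_nonneg [Nonempty (Fin K)] (h : GoodPath L T a x r c μ) (j : ℕ) :
    0 ≤ discountedCorr (1024 * L) T a x c j := by
  induction j with
  | zero => exact le_rfl
  | succ j ih =>
    have h1 := h.sum_corr_nonneg j
    have h2 := state_length_pos (a := a) (x := x) h.lam_pos j
    rw [discountedCorr]
    positivity

lemma prob_mul_length [Nonempty (Fin K)] (h : GoodPath L T a x r c μ) (j : ℕ) (i : Fin K) :
    (state (1024 * L) a x j).pulls (1024 * L) i / (state (1024 * L) a x j).length (1024 * L) *
      (state (1024 * L) a x j).length (1024 * L) = (state (1024 * L) a x j).pulls (1024 * L) i :=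
  div_mul_cancel₀ _ (state_length_pos h.lam_pos j).ne'

lemma prob_nonneg [Nonempty (Fin K)] (h : GoodPath L T a x r c μ) (j : ℕ) (i : Fin K) :
    0 ≤ (state (1024 * L) a x j).pulls (1024 * L) i /
      (state (1024 * L) a x j).length (1024 * L) :=
  div_nonneg (state_pulls_pos h.lam_pos j i).le (state_length_pos h.lam_pos j).le

lemma prob_le_one [Nonempty (Fin K)] (h : GoodPath L T a x r c μ) (j : ℕ) (i : Fin K) :
    (state (1024 * L) a x j).pulls (1024 * L) i /
      (state (1024 * L) a x j).length (1024 * L) ≤ 1 :=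
  div_le_one_of_le₀ (state_pulls_le_length h.lam_pos j i) (state_length_pos h.lam_pos j).le

/-- The number of pulls exceeds the planned one by a small relative amount. -/
lemma count_le [Nonempty (Fin K)] (h : GoodPath L T a x r c μ) {j : ℕ}
    (hj : (state (1024 * L) a x j).time < T) {i : Fin K}
    (hd : (state (1024 * L) a x j).gap i ≤ 1) :
    (∑ t ∈ rounds (1024 * L) a x T j, if a t = i then (1 : ℝ) else 0) ≤
      (state (1024 * L) a x j).pulls (1024 * L) i * (1 + 0.055 * (state (1024 * L) a x j).gap i) := by
  have hd0 := state_gap_pos (l := 1024 * L) (a := a) (x := x) j i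
  have hc := (h.concentrated j (lt_log_of_state_time_lt h.four_le_lam h.horizon hj) i).count
  rw [excess, rate_of_mem hd0.le hd, Finset.sum_const, nsmul_eq_mul] at hc
  have := le_mul_add_of_exp_bound hd0 hd h.two_le (state_pulls_mul_sq j i) (h.prob_mul_length j i)
    (h.prob_nonneg j i) (h.prob_le_one j i) (card_rounds_le h.lam_pos j) (Nat.cast_nonneg _)
    zero_le_one le_rfl hc
  linarith

/-- On a good path the gap estimates never exceed `1`: no arm is pulled so often that its average
could exceed `1` by more than the confidence width. -/
lemma gap_le_one [Nonempty (Fin K)] (h : GoodPath L T a x r c μ) {j : ℕ}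
    (hj : (state (1024 * L) a x j).time ≤ T) (i : Fin K) :
    (state (1024 * L) a x j).gap i ≤ 1 := by
  induction j generalizing i with
  | zero => exact le_rfl
  | succ j ih =>
    have hlt : (state (1024 * L) a x j).time < T :=
      ((strictMono_state_time h.lam_pos) (Nat.lt_succ_self j)).trans_le hj
    have havg0 : ∀ i, 0 ≤ (state (1024 * L) a x j).avg (1024 * L) a x i := fun i => by
      rw [avg_eq_sum_rounds h.lam_pos hj]
      refine div_nonneg (Finset.sum_nonneg fun t ht => ?_) (state_pulls_pos h.lam_pos j i).le
      split_ifs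
      · exact (h.feedback_mem t (Finset.mem_filter.1 ht).1).1
      · exact le_rfl
    have hbest : (state (1024 * L) a x j).best (1024 * L) a x ≤ 1 := by
      refine ciSup_le fun i => ?_
      have hd0 := state_gap_pos (l := 1024 * L) (a := a) (x := x) j i
      have hn := state_pulls_pos (a := a) (x := x) h.lam_pos j i
      have h1 : (state (1024 * L) a x j).avg (1024 * L) a x i ≤
          1 + 0.055 * (state (1024 * L) a x j).gap i := by
        rw [avg_eq_sum_rounds h.lam_pos hj, div_le_iff₀ hn, mul_comm (1 + _)]
        refine le_trans (Finset.sum_le_sum fun t ht => ?_) (h.count_le hlt (ih hlt.le i))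
        split_ifs
        · exact (h.feedback_mem t (Finset.mem_filter.1 ht).1).2
        · exact le_rfl
      linarith
    refine max_le (pow_le_one₀ (by norm_num) (by norm_num)) ?_
    linarith [havg0 i]

/-- The average reward in a complete epoch is within `2 C / N + Δᵢ / 16` of the mean. -/
lemma abs_avg_sub_le [Nonempty (Fin K)] (h : GoodPath L T a x r c μ) {j : ℕ}
    (hj : (state (1024 * L) a x (j + 1)).time ≤ T) (i : Fin K) :
    |(state (1024 * L) a x j).avg (1024 * L) a x i - μ i| ≤
      2 * (∑ t ∈ rounds (1024 * L) a x T j, c t) / (state (1024 * L) a x j).length (1024 * L) +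
        (state (1024 * L) a x j).gap i / 16 := by
  have hlt : (state (1024 * L) a x j).time < T :=
    ((strictMono_state_time h.lam_pos) (Nat.lt_succ_self j)).trans_le hj
  have hd0 := state_gap_pos (l := 1024 * L) (a := a) (x := x) j i
  have hd1 := h.gap_le_one hlt.le i
  have hn := state_pulls_pos (a := a) (x := x) h.lam_pos j i
  have hN := state_length_pos (a := a) (x := x) h.lam_pos j
  have hcon := h.concentrated j (lt_log_of_state_time_lt h.four_le_lam h.horizon hlt) i
  have hu := hcon.upper
  have hlo := hcon.lower
  have hco := hcon.corrupted
  rw [excess, rate_of_mem hd0.le hd1, Finset.sum_const, nsmul_eq_mul] at hu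
  simp only [excess, rate_of_mem hd0.le hd1, Finset.sum_const, nsmul_eq_mul] at hlo
  simp only [excess, one_mul] at hco
  have hA1 := le_mul_add_of_exp_bound hd0 hd1 h.two_le (state_pulls_mul_sq j i) (h.prob_mul_length j i)
    (h.prob_nonneg j i) (h.prob_le_one j i) (card_rounds_le h.lam_pos j) (Nat.cast_nonneg _)
    (h.mean_mem i).1 (h.mean_mem i).2 hu
  have hA2 := mul_sub_le_of_exp_bound hd0 hd1 h.two_le (state_pulls_mul_sq j i) (h.prob_mul_length j i)
    (h.prob_nonneg j i) (h.prob_le_one j i) (card_rounds_le h.lam_pos j)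
    (le_card_rounds h.lam_pos hj) (Nat.cast_nonneg _) (h.mean_mem i).1 (h.mean_mem i).2 hlo
  have hB : |(∑ t ∈ rounds (1024 * L) a x T j, if a t = i then x t else 0) -
      ∑ t ∈ rounds (1024 * L) a x T j, if a t = i then r t i else 0| ≤
      ∑ t ∈ rounds (1024 * L) a x T j, if a t = i then c t else 0 := by
    rw [← Finset.sum_sub_distrib]
    refine (Finset.abs_sum_le_sum_abs _ _).trans (Finset.sum_le_sum fun t ht => ?_)
    split_ifs with hi
    · rw [← hi]; exact h.abs_sub_le t (Finset.mem_filter.1 ht).1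
    · simp
  have hsq := state_pulls_mul_sq (l := 1024 * L) (a := a) (x := x) j i
  have hC0 := h.sum_corr_nonneg j
  have hqC := mul_nonneg (h.prob_nonneg j i) hC0
  have he : Real.exp 1 - 1 ≤ 2 := by linarith [Real.exp_one_lt_d9]
  rw [avg_eq_sum_rounds h.lam_pos hj]
  set n := (state (1024 * L) a x j).pulls (1024 * L) i
  set N := (state (1024 * L) a x j).length (1024 * L)
  set d := (state (1024 * L) a x j).gap i
  set C := ∑ t ∈ rounds (1024 * L) a x T j, c t
  have hBle : (∑ t ∈ rounds (1024 * L) a x T j, if a t = i then c t else 0) ≤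
      n * (2 * C / N) + n * d / 1024 := by
    have h1 : n / N * (Real.exp 1 - 1) * C ≤ n * (2 * C / N) := by
      have := mul_le_mul_of_nonneg_left he hqC
      calc _ = n / N * C * (Real.exp 1 - 1) := by ring
        _ ≤ n / N * C * 2 := this
        _ = _ := by ring
    have h2 : n * d ^ 2 ≤ n * d := by
      rw [pow_two]; nlinarith [mul_nonneg hn.le hd0.le]
    linarith
  have hnd : 0 < n * d := mul_pos hn hd0
  rw [← mul_le_mul_iff_right₀ hn, ← abs_of_pos hn, ← abs_mul, abs_of_pos hn, mul_sub,
    mul_div_cancel₀ _ hn.ne']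
  rw [abs_le] at hB ⊢
  constructor <;> linarith [hB.1, hB.2]

lemma best_le [Nonempty (Fin K)] (h : GoodPath L T a x r c μ) {istar : Fin K}
    (hstar : ∀ i, μ i ≤ μ istar) {j : ℕ} (hj : (state (1024 * L) a x (j + 1)).time ≤ T) :
    (state (1024 * L) a x j).best (1024 * L) a x ≤ μ istar +
      2 * (∑ t ∈ rounds (1024 * L) a x T j, c t) / (state (1024 * L) a x j).length (1024 * L) :=
  ciSup_le fun i => by linarith [(abs_le.1 (h.abs_avg_sub_le hj i)).2, hstar i]

lemma le_best [Nonempty (Fin K)] (h : GoodPath L T a x r c μ) {j : ℕ}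
    (hj : (state (1024 * L) a x (j + 1)).time ≤ T) (i : Fin K) :
    μ i - 2 * (∑ t ∈ rounds (1024 * L) a x T j, c t) /
        (state (1024 * L) a x j).length (1024 * L) - (state (1024 * L) a x j).gap i / 8 ≤
      (state (1024 * L) a x j).best (1024 * L) a x := by
  have h1 := (abs_le.1 (h.abs_avg_sub_le hj i)).1
  have h2 : (state (1024 * L) a x j).avg (1024 * L) a x i - (state (1024 * L) a x j).gap i / 16 ≤
      (state (1024 * L) a x j).best (1024 * L) a x :=
    le_ciSup (f := fun i => (state (1024 * L) a x j).avg (1024 * L) a x i -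
      (state (1024 * L) a x j).gap i / 16) (Set.finite_range _).bddAbove i
  linarith

/-- The gap estimates exceed twice the true gaps only by the resolution of the epoch and the
corruption of earlier epochs. -/
lemma gap_le [Nonempty (Fin K)] (h : GoodPath L T a x r c μ) {istar : Fin K}
    (hstar : ∀ i, μ i ≤ μ istar) {j : ℕ} (hj : (state (1024 * L) a x j).time ≤ T) (i : Fin K) :
    (state (1024 * L) a x j).gap i ≤
      2 * (μ istar - μ i + 2⁻¹ ^ j + discountedCorr (1024 * L) T a x c j) := by
  induction j with
  | zero => simp only [state, discountedCorr, pow_zero]; linarith [hstar i]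
  | succ j ih =>
    have hlt : (state (1024 * L) a x j).time ≤ T :=
      ((strictMono_state_time h.lam_pos) (Nat.lt_succ_self j)).le.trans hj
    have ih := ih hlt
    have h1 := (abs_le.1 (h.abs_avg_sub_le hj i)).1
    have h2 := h.best_le hstar hj
    have h3 := h.discountedCorr_nonneg j
    have h4 := h.discountedCorr_nonneg (j + 1)
    have h5 : (0 : ℝ) < 2⁻¹ ^ j := by positivity
    have h6 : (2⁻¹ : ℝ) ^ (j + 1) = 2⁻¹ ^ j / 2 := by rw [pow_succ]; ring
    rw [discountedCorr] at h4 ⊢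
    refine max_le ?_ ?_
    · linarith [hstar i]
    · linarith [hstar i]

/-- The gap estimates fall below half the true gaps only by the resolution of the epoch and the
corruption of earlier epochs. -/
lemma le_gap [Nonempty (Fin K)] (h : GoodPath L T a x r c μ) {istar : Fin K}
    (hstar : ∀ i, μ i ≤ μ istar) {j : ℕ} (hj : (state (1024 * L) a x j).time ≤ T) (i : Fin K) :
    (μ istar - μ i) / 2 - 3 * discountedCorr (1024 * L) T a x c j - 3 / 4 * 2⁻¹ ^ j ≤
      (state (1024 * L) a x j).gap i := by
  cases j with
  | zero =>
    simp only [state, discountedCorr, pow_zero]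
    linarith [(h.mean_mem istar).2, (h.mean_mem i).1]
  | succ j =>
    have hlt : (state (1024 * L) a x j).time ≤ T :=
      ((strictMono_state_time h.lam_pos) (Nat.lt_succ_self j)).le.trans hj
    have h1 := (abs_le.1 (h.abs_avg_sub_le hj i)).2
    have h2 := h.le_best hj istar
    have h3 := h.gap_le hstar hlt i
    have h4 := h.gap_le hstar hlt istar
    have h5 := div_nonneg (mul_nonneg zero_le_two (h.sum_corr_nonneg j))
      (state_length_pos (a := a) (x := x) h.lam_pos j).le
    have h6 : (2⁻¹ : ℝ) ^ (j + 1) = 2⁻¹ ^ j / 2 := by rw [pow_succ]; ring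
    rw [discountedCorr]
    refine le_trans ?_ (le_max_right _ _)
    linarith [hstar i]

/-- The regret of one arm in one epoch: either the gap estimate is at least a constant fraction of
the true gap, or the true gap is at most a constant times the resolution `2⁻ʲ` of the epoch, or it
is at most a constant times the discounted corruption. -/
lemma count_mul_gap_le [Nonempty (Fin K)] (h : GoodPath L T a x r c μ) {istar : Fin K}
    (hstar : ∀ i, μ i ≤ μ istar) (j : ℕ) {i : Fin K} (hi : μ i < μ istar) :
    (∑ t ∈ rounds (1024 * L) a x T j, if a t = i then (1 : ℝ) else 0) * (μ istar - μ i) ≤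
      2048 * (1024 * L) / (μ istar - μ i) +
        64 * (1024 * L * 4 ^ j * discountedCorr (1024 * L) T a x c j) := by
  have hl := h.lam_pos
  have hρ := h.discountedCorr_nonneg j
  set ρ := discountedCorr (1024 * L) T a x c j
  set D := μ istar - μ i with hD
  have hD0 : 0 < D := sub_pos.2 hi
  have hterm1 : 0 ≤ 2048 * (1024 * L) / D := by positivity
  have hterm2 : 0 ≤ 64 * (1024 * L * 4 ^ j * ρ) := by positivity
  rcases le_or_gt (T : ℝ) (state (1024 * L) a x j).time with hT | hT
  · have hempty : rounds (1024 * L) a x T j = ∅ := by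
      refine Finset.filter_eq_empty_iff.2 fun t ht hin => ?_
      have : (t : ℝ) ≤ T := by exact_mod_cast (Finset.mem_Icc.1 ht).2
      linarith [hin.1]
    rw [hempty, Finset.sum_empty, zero_mul]; positivity
  have hd1 := h.gap_le_one hT.le i
  have hd0 := state_gap_pos (l := 1024 * L) (a := a) (x := x) j i
  have hn0 := state_pulls_pos (a := a) (x := x) hl j i
  have hn4 := state_pulls_le (a := a) (x := x) hl j i
  have hcnt : (∑ t ∈ rounds (1024 * L) a x T j, if a t = i then (1 : ℝ) else 0) ≤
      2 * (state (1024 * L) a x j).pulls (1024 * L) i := by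
    have := h.count_le hT hd1
    nlinarith
  have hsq := state_pulls_mul_sq (l := 1024 * L) (a := a) (x := x) j i
  have hlow := h.le_gap hstar hT.le i
  set n := (state (1024 * L) a x j).pulls (1024 * L) i
  set d := (state (1024 * L) a x j).gap i
  have hmain : n * D ≤ 1024 * (1024 * L) / D + 32 * (1024 * L * 4 ^ j * ρ) := by
    rcases le_or_gt D (2 * 2⁻¹ ^ j) with hA | hA
    · have h4 : (4 : ℝ) ^ j * ((2⁻¹ : ℝ) ^ j) ^ 2 = 1 := by
        rw [← pow_mul, mul_comm j 2, pow_mul, ← mul_pow]; norm_num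
      have h5 : D ^ 2 ≤ 4 * ((2⁻¹ : ℝ) ^ j) ^ 2 := by nlinarith
      have h6 : n * D ≤ 1024 * (1024 * L) / D := by
        rw [le_div_iff₀ hD0]
        calc n * D * D ≤ (1024 * L * 4 ^ j) * D ^ 2 := by
              rw [mul_assoc, ← pow_two]; exact mul_le_mul_of_nonneg_right hn4 (sq_nonneg D)
          _ ≤ (1024 * L * 4 ^ j) * (4 * ((2⁻¹ : ℝ) ^ j) ^ 2) :=
              mul_le_mul_of_nonneg_left h5 (by positivity)
          _ = 4 * (1024 * L) * (4 ^ j * ((2⁻¹ : ℝ) ^ j) ^ 2) := by ring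
          _ ≤ 1024 * (1024 * L) := by rw [h4]; linarith
      linarith
    · rcases le_or_gt D (32 * ρ) with hB | hB
      · have : n * D ≤ (1024 * L * 4 ^ j) * (32 * ρ) :=
          mul_le_mul hn4 hB hD0.le (by positivity)
        have : 0 ≤ 1024 * (1024 * L) / D := by positivity
        linarith
      · have h7 : D / 32 ≤ d := by linarith
        have h8 : n * D ≤ 1024 * (1024 * L) / D := by
          rw [le_div_iff₀ hD0, ← hsq]
          have : (D / 32) ^ 2 ≤ d ^ 2 := pow_le_pow_left₀ (by positivity) h7 2
          have := mul_le_mul_of_nonneg_left this hn0.le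
          linarith
        linarith
  calc _ ≤ 2 * n * D := mul_le_mul_of_nonneg_right hcnt hD0.le
    _ ≤ 2 * (1024 * (1024 * L) / D + 32 * (1024 * L * 4 ^ j * ρ)) := by linarith
    _ = _ := by ring

/-- Since epoch `j` has length at least `λ 4ʲ`, the discounted corruptions add up to a constant
times the total corruption. -/
lemma sum_discountedCorr_le [Nonempty (Fin K)] (h : GoodPath L T a x r c μ) (M : ℕ) :
    ∑ j ∈ Finset.range M, 1024 * L * 4 ^ j * discountedCorr (1024 * L) T a x c j ≤
      16 * ∑ j ∈ Finset.range M, ∑ t ∈ rounds (1024 * L) a x T j, c t := by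
  have key : ∀ M, ∑ j ∈ Finset.range M, 1024 * L * 4 ^ j * discountedCorr (1024 * L) T a x c j +
      2 * (1024 * L * 4 ^ M * discountedCorr (1024 * L) T a x c M) ≤
      16 * ∑ j ∈ Finset.range M, ∑ t ∈ rounds (1024 * L) a x T j, c t := by
    intro M
    -- the extra term `2 u_M` pays for the geometric tail: `u_{M+1} ≤ 8 C_M + u_M / 2`
    induction M with
    | zero => simp [discountedCorr]
    | succ M ih =>
      rw [Finset.sum_range_succ, Finset.sum_range_succ, discountedCorr]
      have hC := h.sum_corr_nonneg M
      have hN := state_length_pos (a := a) (x := x) h.lam_pos M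
      have h1 : 1024 * L * 4 ^ M * ((∑ t ∈ rounds (1024 * L) a x T M, c t) /
          (state (1024 * L) a x M).length (1024 * L)) ≤ ∑ t ∈ rounds (1024 * L) a x T M, c t := by
        rw [mul_div_assoc', div_le_iff₀ hN, mul_comm (∑ t ∈ _, c t)]
        exact mul_le_mul_of_nonneg_right (le_state_length h.lam_pos M) hC
      rw [pow_succ, mul_div_assoc]
      linarith
  have h1 := key M
  have h2 := h.discountedCorr_nonneg M
  have h3 := h.lam_pos
  have : 0 ≤ 2 * (1024 * L * 4 ^ M * discountedCorr (1024 * L) T a x c M) := by positivity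
  linarith

/-- The regret bound on a good path. -/
lemma sum_regret_le (h : GoodPath L T a x r c μ) {istar : Fin K}
    (hstar : ∀ i, i ≠ istar → μ i < μ istar) :
    ∑ t ∈ Finset.Icc 1 T, (μ istar - μ (a t)) ≤
      1024 * (K * ∑ t ∈ Finset.Icc 1 T, c t) +
        2048 * (1024 * L) * (Nat.log 2 T * ∑ i ∈ Finset.univ.erase istar, (μ istar - μ i)⁻¹) := by
  have : Nonempty (Fin K) := ⟨istar⟩
  have hle : ∀ i, μ i ≤ μ istar := fun i => by
    by_cases hi : i = istar
    · rw [hi]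
    · exact (hstar i hi).le
  have hepoch : ∀ j, ∑ t ∈ rounds (1024 * L) a x T j, (μ istar - μ (a t)) =
      ∑ i ∈ Finset.univ.erase istar,
        (∑ t ∈ rounds (1024 * L) a x T j, if a t = i then (1 : ℝ) else 0) * (μ istar - μ i) := by
    intro j
    rw [Finset.sum_erase _ (by simp)]
    simp only [Finset.sum_mul]
    rw [Finset.sum_comm]
    refine Finset.sum_congr rfl fun t _ => ?_
    simp
  have hu : 0 ≤ ∑ j ∈ Finset.range (Nat.log 2 T),
      1024 * L * 4 ^ j * discountedCorr (1024 * L) T a x c j :=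
    Finset.sum_nonneg fun j _ => mul_nonneg
      (mul_nonneg h.lam_pos.le (by positivity)) (h.discountedCorr_nonneg j)
  have hcard : ((Finset.univ.erase istar).card : ℝ) ≤ K := by
    exact_mod_cast (Finset.card_le_univ _).trans (Fintype.card_fin K).le
  rw [sum_rounds (a := a) (x := x) h.four_le_lam h.horizon,
    sum_rounds (a := a) (x := x) h.four_le_lam h.horizon c]
  calc _ ≤ ∑ j ∈ Finset.range (Nat.log 2 T), ∑ i ∈ Finset.univ.erase istar,
        (2048 * (1024 * L) * (μ istar - μ i)⁻¹ +
          64 * (1024 * L * 4 ^ j * discountedCorr (1024 * L) T a x c j)) :=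
        Finset.sum_le_sum fun j _ => by
          rw [hepoch]
          exact Finset.sum_le_sum fun i hi =>
            h.count_mul_gap_le hle j (hstar i (Finset.ne_of_mem_erase hi))
    _ = 2048 * (1024 * L) * (Nat.log 2 T * ∑ i ∈ Finset.univ.erase istar, (μ istar - μ i)⁻¹) +
        64 * ((Finset.univ.erase istar).card * ∑ j ∈ Finset.range (Nat.log 2 T),
          1024 * L * 4 ^ j * discountedCorr (1024 * L) T a x c j) := by
        simp only [Finset.sum_add_distrib, Finset.sum_const, Finset.card_range, nsmul_eq_mul,
          ← Finset.mul_sum]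
        ring
    _ ≤ _ := by
        have h1 := mul_le_mul hcard (h.sum_discountedCorr_le (Nat.log 2 T)) hu (Nat.cast_nonneg K)
        linarith

end GoodPath

end Path

/-! ### Constants, and the passage from high probability to expectation -/

section Constants

variable {K T : ℕ} {δ : ℝ}

lemma one_le_logb_two (hT : 2 ≤ T) : 1 ≤ Real.logb 2 T := by
  rw [Real.le_logb_iff_rpow_le (by norm_num) (by positivity), Real.rpow_one]
  exact_mod_cast hT

lemma natLog_le_logb (hT : 2 ≤ T) : (Nat.log 2 T : ℝ) ≤ Real.logb 2 T := by
  rw [Real.le_logb_iff_rpow_le (by norm_num) (by positivity), Real.rpow_natCast]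
  exact_mod_cast Nat.pow_log_le_self 2 (by omega)

lemma eight_le_arg (hK : 1 ≤ K) (hT : 2 ≤ T) (hδ0 : 0 < δ) (hδ1 : δ < 1) :
    8 ≤ 8 * K / δ * Real.logb 2 T := by
  have hK' : (1 : ℝ) ≤ K := by exact_mod_cast hK
  have h1 : (8 : ℝ) ≤ 8 * K / δ := by rw [le_div_iff₀ hδ0]; nlinarith
  nlinarith [one_le_logb_two hT]

lemma two_le_log_arg (hK : 1 ≤ K) (hT : 2 ≤ T) (hδ0 : 0 < δ) (hδ1 : δ < 1) :
    2 ≤ Real.log (8 * K / δ * Real.logb 2 T) := by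
  have h1 := Real.log_le_log (by norm_num) (eight_le_arg hK hT hδ0 hδ1)
  have h2 : Real.log 8 = 3 * Real.log 2 := by
    rw [show (8 : ℝ) = 2 ^ 3 by norm_num, Real.log_pow]; norm_num
  linarith [Real.log_two_gt_d9]

/-- The failure probability of the union bound over at most `log₂ T` epochs. -/
lemma union_bound_le (hK : 1 ≤ K) (hT : 2 ≤ T) (hδ0 : 0 < δ) (hδ1 : δ < 1) :
    Nat.log 2 T * K * (4 * Real.exp (-Real.log (8 * K / δ * Real.logb 2 T))) ≤ δ := by
  have h8 := eight_le_arg hK hT hδ0 hδ1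
  have hK' : (1 : ℝ) ≤ K := by exact_mod_cast hK
  have hb := one_le_logb_two hT
  rw [Real.exp_neg, Real.exp_log (by linarith)]
  calc (Nat.log 2 T : ℝ) * K * (4 * (8 * K / δ * Real.logb 2 T)⁻¹)
      ≤ Real.logb 2 T * K * (4 * (8 * K / δ * Real.logb 2 T)⁻¹) := by
        gcongr
        exact natLog_le_logb hT
    _ = δ / 2 := by
        have : Real.logb 2 T ≠ 0 := by linarith
        field_simp; norm_num
    _ ≤ δ := by linarith

lemma logb_two_le (hT : 2 ≤ T) : Real.logb 2 T ≤ 1.5 * Real.log T := by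
  have h2 := Real.log_two_gt_d9
  have hT' : (2 : ℝ) ≤ T := by exact_mod_cast hT
  have h0 : 0 ≤ Real.log T := Real.log_nonneg (by linarith)
  rw [Real.logb, div_le_iff₀ (by linarith)]
  nlinarith

lemma log_two_le_log (hT : 2 ≤ T) : Real.log 2 ≤ Real.log T :=
  Real.log_le_log (by norm_num) (by exact_mod_cast hT)

/-- With at least two arms `K / δ * log T ≥ 2 log 2 > 1.38`, so the constants inside the logarithm
only cost a constant factor. -/
lemma log_arg_le (hK : 2 ≤ K) (hT : 2 ≤ T) (hδ0 : 0 < δ) (hδ1 : δ < 1) :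
    Real.log (8 * K / δ * Real.logb 2 T) ≤ 9 * Real.log (K / δ * Real.log T) := by
  have hK' : (2 : ℝ) ≤ K := by exact_mod_cast hK
  have h2 := Real.log_two_gt_d9
  have hT2 := log_two_le_log hT
  have hKδ : (2 : ℝ) ≤ K / δ := by rw [le_div_iff₀ hδ0]; nlinarith
  set y := (K : ℝ) / δ * Real.log T with hy
  have hy1 : 1.38 ≤ y := by nlinarith
  have hy8 : (12 : ℝ) ≤ y ^ 8 :=
    le_trans (by norm_num) (pow_le_pow_left₀ (by norm_num) hy1 8)
  have hpos : 0 < 8 * K / δ * Real.logb 2 T := by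
    linarith [eight_le_arg (by omega : 1 ≤ K) hT hδ0 hδ1]
  have hle : 8 * K / δ * Real.logb 2 T ≤ y ^ 9 := by
    calc 8 * K / δ * Real.logb 2 T ≤ 8 * K / δ * (1.5 * Real.log T) := by
          gcongr; exact logb_two_le hT
      _ = 12 * y := by rw [hy]; ring
      _ ≤ y ^ 8 * y := by gcongr
      _ = y ^ 9 := by ring
  calc _ ≤ Real.log (y ^ 9) := Real.log_le_log hpos hle
    _ = _ := by rw [Real.log_pow]; norm_num

lemma log_arg_nonneg (hK : 2 ≤ K) (hT : 2 ≤ T) (hδ0 : 0 < δ) (hδ1 : δ < 1) :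
    0 ≤ Real.log (K / δ * Real.log T) := by
  linarith [log_arg_le hK hT hδ0 hδ1, two_le_log_arg (by omega : 1 ≤ K) hT hδ0 hδ1]

lemma const_le (hK : 2 ≤ K) (hT : 2 ≤ T) (hδ0 : 0 < δ) (hδ1 : δ < 1) :
    2048 * (1024 * Real.log (8 * K / δ * Real.logb 2 T)) * Nat.log 2 T ≤
      3 * 10 ^ 7 * (Real.log T * Real.log (K / δ * Real.log T)) := by
  have h1 := log_arg_le hK hT hδ0 hδ1
  have h2 := (natLog_le_logb hT).trans (logb_two_le hT)
  have h3 := log_arg_nonneg hK hT hδ0 hδ1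
  have h4 : 0 ≤ Real.log T := by linarith [log_two_le_log hT, Real.log_two_gt_d9]
  have h5 := mul_le_mul h1 h2 (Nat.cast_nonneg _) (by positivity)
  have h6 := mul_nonneg h4 h3
  linarith

lemma norm_sub_le_one {u v : Fin K → ℝ} (hu : ∀ i, u i ∈ Set.Icc (0 : ℝ) 1)
    (hv : ∀ i, v i ∈ Set.Icc (0 : ℝ) 1) : ‖u - v‖ ≤ 1 := by
  refine (pi_norm_le_iff_of_nonneg zero_le_one).2 fun i => ?_
  rw [Pi.sub_apply, Real.norm_eq_abs, abs_le]
  constructor <;> linarith [(hu i).1, (hu i).2, (hv i).1, (hv i).2]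

lemma corruption_nonneg {Ω : Type*} {R R' : ℕ → Ω → Fin K → ℝ} (ω : Ω) : 0 ≤ corruption T R R' ω :=
  Finset.sum_nonneg fun _ _ => norm_nonneg _

lemma regret_mem_Icc {Ω : Type*} {I : ℕ → Ω → Fin K} {ν : Fin K → Measure ℝ} {istar : Fin K}
    (hμ : ∀ i, mean ν i ∈ Set.Icc (0 : ℝ) 1)
    (hstar : ∀ i, mean ν i ≤ mean ν istar) (ω : Ω) :
    regret ν istar T I ω ∈ Set.Icc (0 : ℝ) T := by
  refine ⟨Finset.sum_nonneg fun t _ => sub_nonneg.2 (hstar _), ?_⟩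
  calc regret ν istar T I ω ≤ ∑ t ∈ Finset.Icc 1 T, (1 : ℝ) :=
        Finset.sum_le_sum fun t _ => by linarith [(hμ istar).2, (hμ (I t ω)).1]
    _ = T := by simp

lemma gap_pos {ν : Fin K → Measure ℝ} {istar : Fin K}
    (hstar : ∀ i, i ≠ istar → mean ν i < mean ν istar) {i : Fin K}
    (hi : i ∈ Finset.univ.erase istar) : 0 < gap ν istar i :=
  sub_pos.2 (hstar i (Finset.ne_of_mem_erase hi))

lemma two_le_of_mem_erase {i istar : Fin K} (hi : i ∈ Finset.univ.erase istar) : 2 ≤ K := by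
  have := Fin.val_ne_of_ne (Finset.ne_of_mem_erase hi)
  have := i.isLt
  have := istar.isLt
  omega

lemma regret_term_le {ν : Fin K → Measure ℝ} {istar : Fin K}
    (hstar : ∀ i, i ≠ istar → mean ν i < mean ν istar) (hT : 2 ≤ T) (hδ0 : 0 < δ) (hδ1 : δ < 1) :
    2048 * (1024 * Real.log (8 * K / δ * Real.logb 2 T)) *
        (Nat.log 2 T * ∑ i ∈ Finset.univ.erase istar, (gap ν istar i)⁻¹) ≤
      3 * 10 ^ 7 * ∑ i ∈ Finset.univ.erase istar,
        Real.log T / gap ν istar i * Real.log (K / δ * Real.log T) := by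
  rw [← mul_assoc, Finset.mul_sum, Finset.mul_sum]
  refine Finset.sum_le_sum fun i hi => ?_
  have := mul_le_mul_of_nonneg_right (const_le (two_le_of_mem_erase hi) hT hδ0 hδ1)
    (inv_pos.2 (gap_pos hstar hi)).le
  rw [div_eq_mul_inv (Real.log T)]
  linarith

end Constants

section Main

variable {K T : ℕ} {δ : ℝ} {Ω : Type*} [MeasurableSpace Ω] {P : Measure Ω}
  {ν : Fin K → Measure ℝ} {R R' : ℕ → Ω → Fin K → ℝ} {I : ℕ → Ω → Fin K} {istar : Fin K}

lemma IsBarbarRun.measurable_regret (h : IsBarbarRun P ν δ T R R' I) :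
    Measurable (regret ν istar T I) :=
  Finset.measurable_fun_sum _ fun t ht => measurable_const.sub
    ((measurable_of_countable (mean ν)).comp (h.measurable_arm t ht))

lemma IsBarbarRun.measurable_corruption (h : IsBarbarRun P ν δ T R R' I) :
    Measurable (corruption T R R') :=
  Finset.measurable_fun_sum _ fun t ht =>
    ((h.measurable_corrupted t ht).sub (h.measurable_reward t ht)).norm

variable [IsProbabilityMeasure P]

lemma IsBarbarRun.integrable_corruption (h : IsBarbarRun P ν δ T R R' I)
    (hν : ∀ i, ∀ᵐ y ∂(ν i), y ∈ Set.Icc (0 : ℝ) 1) : Integrable (corruption T R R') P := by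
  refine Integrable.of_bound h.measurable_corruption.aestronglyMeasurable T ?_
  filter_upwards [h.ae_reward_mem hν] with ω hω
  rw [Real.norm_eq_abs, abs_of_nonneg (corruption_nonneg ω)]
  calc corruption T R R' ω ≤ ∑ t ∈ Finset.Icc 1 T, (1 : ℝ) :=
        Finset.sum_le_sum fun t ht => norm_sub_le_one (h.corrupted_mem t ht ω) (hω t ht)
    _ = T := by simp

/-- On the concentration event, the sample path is good, as almost surely neither the rewards nor
the corruption are truncated. -/
lemma IsBarbarRun.measureReal_not_regret_le (h : IsBarbarRun P ν δ T R R' I) (hT : 2 ≤ T)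
    (hδ0 : 0 < δ) (hδ1 : δ < 1) (hν' : ∀ i, IsProbabilityMeasure (ν i))
    (hν : ∀ i, ∀ᵐ y ∂(ν i), y ∈ Set.Icc (0 : ℝ) 1)
    (hstar : ∀ i, i ≠ istar → mean ν i < mean ν istar) :
    P.real {ω | ¬ regret ν istar T I ω ≤ 1024 * (K * corruption T R R' ω) +
      2048 * (1024 * Real.log (8 * K / δ * Real.logb 2 T)) *
        (Nat.log 2 T * ∑ i ∈ Finset.univ.erase istar, (gap ν istar i)⁻¹)} ≤ δ := by
  have hK : 1 ≤ K := Nat.one_le_iff_ne_zero.2 fun h0 => by subst h0; exact istar.elim0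
  have hL := two_le_log_arg hK hT hδ0 hδ1
  have hlam : 0 < lam K δ T := by rw [lam]; linarith
  refine le_trans ?_ ((h.measureReal_not_concentrated_le hlam hν' hν _ _).trans
    (union_bound_le hK hT hδ0 hδ1))
  refine ENNReal.toReal_mono (measure_ne_top P _) (measure_mono_ae ?_)
  filter_upwards [h.ae_reward_mem hν] with ω hω hbad hconc
  refine hbad ?_
  have hcorr : ∀ t ∈ Finset.Icc 1 T, corr R R' t ω = ‖R' t ω - R t ω‖ := fun t ht =>
    min_eq_right (norm_sub_le_one (h.corrupted_mem t ht ω) (hω t ht))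
  have hgood : GoodPath (Real.log (8 * K / δ * Real.logb 2 T)) T (fun s => I s ω)
      (fun s => R' s ω (I s ω)) (fun t k => clip (R t ω k)) (fun t => corr R R' t ω) (mean ν) :=
    { two_le := hL
      horizon := hT
      feedback_mem := fun t ht => h.corrupted_mem t ht ω _
      abs_sub_le := fun t ht => by
        rw [hcorr t ht, clip_of_mem (hω t ht _)]
        exact norm_le_pi_norm (R' t ω - R t ω) (I t ω)
      mean_mem := fun i => by have := hν' i; exact mean_mem_Icc (hν i)
      concentrated := hconc }
  have hreg := hgood.sum_regret_le hstar
  rw [Finset.sum_congr rfl hcorr] at hreg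
  exact hreg

/-- The regret bound that holds with probability at least `1 - δ`. -/
lemma IsBarbarRun.one_sub_le_measureReal_regret_le (h : IsBarbarRun P ν δ T R R' I) (hT : 2 ≤ T)
    (hδ0 : 0 < δ) (hδ1 : δ < 1) (hν' : ∀ i, IsProbabilityMeasure (ν i))
    (hν : ∀ i, ∀ᵐ y ∂(ν i), y ∈ Set.Icc (0 : ℝ) 1)
    (hstar : ∀ i, i ≠ istar → mean ν i < mean ν istar) :
    1 - δ ≤ P.real {ω | regret ν istar T I ω ≤ 10 ^ 8 * (K * corruption T R R' ω +
      ∑ i ∈ Finset.univ.erase istar,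
        Real.log T / gap ν istar i * Real.log (K / δ * Real.log T))} := by
  have hlogT : 0 ≤ Real.log T := by linarith [log_two_le_log hT, Real.log_two_gt_d9]
  have hbad := h.measureReal_not_regret_le hT hδ0 hδ1 hν' hν hstar
  have hcover := measureReal_union_le (μ := P)
    {ω | regret ν istar T I ω ≤ 10 ^ 8 * (K * corruption T R R' ω +
      ∑ i ∈ Finset.univ.erase istar,
        Real.log T / gap ν istar i * Real.log (K / δ * Real.log T))}
    {ω | ¬ regret ν istar T I ω ≤ 1024 * (K * corruption T R R' ω) +
      2048 * (1024 * Real.log (8 * K / δ * Real.logb 2 T)) *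
      (Nat.log 2 T * ∑ i ∈ Finset.univ.erase istar, (gap ν istar i)⁻¹)}
  rw [Set.eq_univ_of_forall (s := _ ∪ _), probReal_univ] at hcover
  · linarith
  · intro ω
    rw [Set.mem_union, or_iff_not_imp_right]
    intro hω
    simp only [Set.mem_ofPred_eq, not_not] at hω ⊢
    have h1 := regret_term_le hstar hT hδ0 hδ1
    have h2 : 0 ≤ ∑ i ∈ Finset.univ.erase istar,
        Real.log T / gap ν istar i * Real.log (K / δ * Real.log T) :=
      Finset.sum_nonneg fun i hi => mul_nonneg (div_nonneg hlogT (gap_pos hstar hi).le)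
        (log_arg_nonneg (two_le_of_mem_erase hi) hT hδ0 hδ1)
    have h3 : 0 ≤ K * corruption T R R' ω := mul_nonneg (Nat.cast_nonneg K) (corruption_nonneg ω)
    linarith

/-- The regret bound in expectation, obtained from the bound with high probability. -/
lemma IsBarbarRun.integral_regret_le (h : IsBarbarRun P ν (1 / T) T R R' I) (hT : 2 ≤ T)
    (hν' : ∀ i, IsProbabilityMeasure (ν i)) (hν : ∀ i, ∀ᵐ y ∂(ν i), y ∈ Set.Icc (0 : ℝ) 1)
    (hstar : ∀ i, i ≠ istar → mean ν i < mean ν istar) :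
    Integrable (regret ν istar T I) P ∧ Integrable (corruption T R R') P ∧
      ∫ ω, regret ν istar T I ω ∂P ≤ 10 ^ 8 * (K * ∫ ω, corruption T R R' ω ∂P +
        ∑ i ∈ Finset.univ.erase istar, Real.log (K * T) ^ 2 / gap ν istar i) := by
  have hμ : ∀ i, mean ν i ∈ Set.Icc (0 : ℝ) 1 := fun i => by
    have := hν' i
    exact mean_mem_Icc (hν i)
  have hle : ∀ i, mean ν i ≤ mean ν istar := fun i => by
    by_cases hi : i = istar
    · rw [hi]
    · exact (hstar i hi).le
  have hT' : (2 : ℝ) ≤ T := by exact_mod_cast hT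
  have hδ0 : (0 : ℝ) < 1 / T := by positivity
  have hδ1 : (1 : ℝ) / T < 1 := by rw [div_lt_one (by linarith)]; linarith
  have hreg := regret_mem_Icc (I := I) (T := T) hμ hle
  have hregi : Integrable (regret ν istar T I) P :=
    Integrable.of_bound h.measurable_regret.aestronglyMeasurable T (ae_of_all _ fun ω => by
      rw [Real.norm_eq_abs, abs_of_nonneg (hreg ω).1]; exact (hreg ω).2)
  have hcori := h.integrable_corruption hν
  refine ⟨hregi, hcori, ?_⟩
  have hcor0 : 0 ≤ K * ∫ ω, corruption T R R' ω ∂P :=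
    mul_nonneg (Nat.cast_nonneg K) (integral_nonneg corruption_nonneg)
  rcases (Finset.univ.erase istar).eq_empty_or_nonempty with hemp | ⟨i₀, hi₀⟩
  · -- a single arm has no regret
    have hzero : ∀ ω, regret ν istar T I ω = 0 := fun ω => by
      refine Finset.sum_eq_zero fun t _ => ?_
      have : I t ω = istar := by
        by_contra hne
        exact Finset.notMem_empty (I t ω)
          (hemp ▸ Finset.mem_erase.2 ⟨hne, Finset.mem_univ _⟩)
      rw [this, sub_self]
    simp only [hzero, integral_zero, hemp, Finset.sum_empty, add_zero]
    positivity
  · have hK2 : (2 : ℝ) ≤ K := by exact_mod_cast two_le_of_mem_erase hi₀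
    have hbad := h.measureReal_not_regret_le hT hδ0 hδ1 hν' hν hstar
    have hW := regret_term_le hstar hT hδ0 hδ1
    set W := 2048 * (1024 * Real.log (8 * K / (1 / T : ℝ) * Real.logb 2 T)) *
      (Nat.log 2 T * ∑ i ∈ Finset.univ.erase istar, (gap ν istar i)⁻¹) with hWdef
    set bad := {ω | ¬ regret ν istar T I ω ≤ 1024 * (K * corruption T R R' ω) + W} with hbaddef
    have hbadm : MeasurableSet bad := (measurableSet_le h.measurable_regret
      (((h.measurable_corruption.const_mul _).const_mul _).add_const _)).compl
    have hW0 : 0 ≤ W := by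
      have := two_le_log_arg (one_le_two.trans (two_le_of_mem_erase hi₀)) hT hδ0 hδ1
      refine mul_nonneg (by linarith) (mul_nonneg (Nat.cast_nonneg _) ?_)
      exact Finset.sum_nonneg fun i hi => (inv_pos.2 (gap_pos hstar hi)).le
    have hci : Integrable (fun ω => 1024 * (K * corruption T R R' ω) + W) P :=
      ((hcori.const_mul _).const_mul _).add (integrable_const W)
    have hbi : Integrable (bad.indicator fun _ => (T : ℝ)) P :=
      (integrable_const _).indicator hbadm
    -- on the bad event the regret is at most `T`
    have hpoint : ∀ ω, regret ν istar T I ω ≤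
        (1024 * (K * corruption T R R' ω) + W) + bad.indicator (fun _ => (T : ℝ)) ω := fun ω => by
      by_cases hω : ω ∈ bad
      · rw [Set.indicator_of_mem hω]
        have := mul_nonneg (Nat.cast_nonneg (α := ℝ) K)
          (corruption_nonneg (T := T) (R := R) (R' := R') ω)
        linarith [(hreg ω).2]
      · rw [Set.indicator_of_notMem hω, add_zero]
        exact not_not.1 hω
    have hmono := integral_mono hregi (hci.add hbi) hpoint
    rw [integral_add' hci hbi, integral_add ((hcori.const_mul _).const_mul _)
      (integrable_const W), integral_const_mul, integral_const_mul, integral_const, probReal_univ,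
      integral_indicator_const _ hbadm] at hmono
    simp only [smul_eq_mul, one_mul] at hmono
    have hbadT : P.real bad * T ≤ 1 := by
      rwa [← le_div_iff₀ (by linarith)]
    have hKT : (4 : ℝ) ≤ K * T := by nlinarith
    have hlog4 : 1 ≤ Real.log (K * T) := by
      have h1 := Real.log_le_log (by norm_num) hKT
      have h2 : Real.log 4 = 2 * Real.log 2 := by
        rw [show (4 : ℝ) = 2 ^ 2 by norm_num, Real.log_pow]; norm_num
      linarith [Real.log_two_gt_d9]
    have hTKT : (T : ℝ) ≤ K * T := by nlinarith
    have hterm : ∀ i ∈ Finset.univ.erase istar,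
        Real.log T / gap ν istar i * Real.log (K / (1 / T : ℝ) * Real.log T) ≤
          2 * (Real.log (K * T) ^ 2 / gap ν istar i) := fun i hi => by
      have h1 : Real.log T ≤ Real.log (K * T) := Real.log_le_log (by linarith) hTKT
      have h2 : Real.log (K / (1 / T : ℝ) * Real.log T) ≤ 2 * Real.log (K * T) := by
        have hlt : Real.log T ≤ K * T := (Real.log_le_self (by linarith)).trans hTKT
        have hp : 0 < Real.log T := Real.log_pos (by linarith)
        have : (K / (1 / T : ℝ) * Real.log T) ≤ (K * T) ^ 2 := by
          rw [div_div_eq_mul_div, div_one, pow_two]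
          exact mul_le_mul_of_nonneg_left hlt (by linarith)
        calc _ ≤ Real.log ((K * T : ℝ) ^ 2) := Real.log_le_log (by positivity) this
          _ = _ := by rw [Real.log_pow]; norm_num
      have h3 := log_arg_nonneg (two_le_of_mem_erase hi) hT hδ0 hδ1
      rw [div_mul_eq_mul_div, ← mul_div_assoc]
      refine div_le_div_of_nonneg_right ?_ (gap_pos hstar hi).le
      calc _ ≤ Real.log (K * T) * (2 * Real.log (K * T)) := mul_le_mul h1 h2 h3 (by linarith)
        _ = _ := by ring
    have hsum : ∑ i ∈ Finset.univ.erase istar,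
        Real.log T / gap ν istar i * Real.log (K / (1 / T : ℝ) * Real.log T) ≤
        2 * ∑ i ∈ Finset.univ.erase istar, Real.log (K * T) ^ 2 / gap ν istar i := by
      rw [Finset.mul_sum]; exact Finset.sum_le_sum hterm
    -- the failure probability `1 / T` costs at most `1`, which any suboptimal arm pays for
    have hone : 1 ≤ ∑ i ∈ Finset.univ.erase istar, Real.log (K * T) ^ 2 / gap ν istar i := by
      refine le_trans ?_ (Finset.single_le_sum
        (f := fun i => Real.log (K * T) ^ 2 / gap ν istar i)
        (fun i hi => div_nonneg (sq_nonneg _) (gap_pos hstar hi).le) hi₀)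
      rw [one_le_div (gap_pos hstar hi₀)]
      have : gap ν istar i₀ ≤ 1 := by
        unfold gap; linarith [(hμ istar).2, (hμ i₀).1]
      nlinarith
    linarith

end Main
end CorruptedBandit

theorem theorem1 :
    ∃ c : ℝ, 0 < c ∧
      ∀ (K T : ℕ), 2 ≤ T →
      ∀ (ν : Fin K → Measure ℝ), (∀ i, IsProbabilityMeasure (ν i)) →
        (∀ i, ∀ᵐ y ∂(ν i), y ∈ Set.Icc (0 : ℝ) 1) →
      ∀ istar : Fin K,
        (∀ i, i ≠ istar → CorruptedBandit.mean ν i < CorruptedBandit.mean ν istar) →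
      ∀ (Ω : Type*) [MeasurableSpace Ω] (P : Measure Ω) [IsProbabilityMeasure P]
        (R R' : ℕ → Ω → Fin K → ℝ) (I : ℕ → Ω → Fin K),
        (∀ δ : ℝ, 0 < δ → δ < 1 → CorruptedBandit.IsBarbarRun P ν δ T R R' I →
          1 - δ ≤ P.real {ω | CorruptedBandit.regret ν istar T I ω ≤
            c * (K * CorruptedBandit.corruption T R R' ω +
              ∑ i ∈ Finset.univ.erase istar,
                Real.log T / CorruptedBandit.gap ν istar i *
                  Real.log (K / δ * Real.log T))}) ∧
        (CorruptedBandit.IsBarbarRun P ν (1 / T) T R R' I →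
          Integrable (CorruptedBandit.regret ν istar T I) P ∧
          Integrable (CorruptedBandit.corruption T R R') P ∧
          ∫ ω, CorruptedBandit.regret ν istar T I ω ∂P ≤
            c * (K * ∫ ω, CorruptedBandit.corruption T R R' ω ∂P +
              ∑ i ∈ Finset.univ.erase istar,
                Real.log (K * T) ^ 2 / CorruptedBandit.gap ν istar i)) := by
  refine ⟨10 ^ 8, by norm_num, fun K T hT ν hν' hν istar hstar Ω _ P _ R R' I => ⟨?_, ?_⟩⟩
  · exact fun δ hδ0 hδ1 h => h.one_sub_le_measureReal_regret_le hT hδ0 hδ1 hν' hν hstar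
  · exact fun h => h.integral_regret_le hT hν' hν hstar
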